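/- Let a qubit with Hamiltonian $\hat H_S=\omega|1\rangle\langle 1|$, $\omega>0$, in an arbitrary state $\hat\rho_S$ be coupled to a weight with Hilbert space $L^2(\mathbb R)$, whose Hamiltonian $\hat H_W$ is multiplication by the energy $E$, in a state $\hat\rho_W$ with finite energy variance and $\langle \hat H_W\rangle_{\hat\rho_W}=0$. Let $\hat\Delta_W=-i\,d/dE$ and $\hat S=e^{-i\hat H_S\otimes\hat\Delta_W}$. A work extraction protocol is the map $\hat\rho_S\otimes\hat\rho_W\mapsto \hat U(\hat\rho_S\otimes\hat\rho_W)\hat U^\dagger$ with $\hat U=\hat S^\dagger\hat V_S\hat S$ and $\hat V_S$ a unitary on the qubit; $\Delta E_W$ and $\Delta\sigma_W^2$ denote the resulting changes of the mean and of the variance of the energy of the weight. Let $$W(E,t)=\frac1{2\pi}\int d\nu\, e^{i\nu t}\,\langle E-\tfrac\nu2|\hat\rho_W|E+\tfrac\nu2\rangle$$ be the Wigner function of $\hat\rho_W$. Let the control-marginal state $\hat\sigma_S=\mathrm{Tr}_W[\hat S(\hat\rho_S\otimes\hat\rho_W)\hat S^\dagger]$ have the diagonal form $\hat\sigma_S=p|\psi_0\rangle\langle\psi_0|+(1-p)|\psi_1\rangle\langle\psi_1|$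 with $\psi_0,\psi_1$ orthonormal and $p<\tfrac12$, and put $\varepsilon_i=\frac1\omega\langle\psi_i|\hat H_S|\psi_i\rangle$. Let $$\gamma=\int dt\int dE\,W(E,t)e^{i\omega t},\qquad \eta=\frac1\omega\int dt\int dE\,E\,W(E,t)\Big(\frac{e^{i\omega t}}{\gamma}+\frac{e^{-i\omega t}}{\gamma^*}\Big),$$ $$\xi=\frac1\omega\int dt\int dE\,E\,W(E,t)\Big(\frac{\varepsilon_1e^{i\omega t}}{\gamma}-\frac{\varepsilon_0e^{-i\omega t}}{\gamma^*}\Big),$$ where $\gamma\neq0$ and the integral of $E\,W(E,t)$ is assumed to exist (for almost every $t$ the function $E\mapsto E\,W(E,t)$ is integrable, and $t\mapsto\int E\,W(E,t)\,dE$ is integrable). Define $$f(w)=-w^2+\Big(\frac{\varepsilon_1-\varepsilon_0}{1-2p}+4\varepsilon_0\varepsilon_1\eta\Big)w+2\varepsilon_0\varepsilon_1\big[1-(1-2p)(\varepsilon_1-\varepsilon_0)\eta\big],$$ $$h(w)=2R\sqrt{\varepsilon_0\varepsilon_1\Big(\varepsilon_0+\frac{w}{1-2p}\Big)\Big(\varepsilon_1-\frac{w}{1-2p}\Big)},\qquad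 R=\big|1-2(1-2p)\xi\big|.$$ Then $\eta$ is real, the energy variance of the weight after every protocol is finite, and, as $\hat V_S$ ranges over all unitaries on the qubit, the set of pairs $(\Delta E_W/\omega,\ \Delta\sigma_W^2/\omega^2)$ is exactly $$\big\{(w,v):\ w\in[-\varepsilon_0(1-2p),\,\varepsilon_1(1-2p)],\ \ v\in[f(w)-h(w),\,f(w)+h(w)]\big\}.$$ -/

import Mathlib

open MeasureTheory
open scoped ComplexOrder

noncomputable section

namespace QubitWeight

/-! ### States of the weight

The weight has the Hilbert space `L²(ℝ)` in the energy representation, so that its Hamiltonian `H_W`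
is multiplication by the energy `E`. -/

/-- A state (density operator) `ρ_W = ∑ₙ qₙ |φₙ⟩⟨φₙ|` of the weight: nonnegative probabilities `qₙ`
of total mass one and unit vectors `φₙ` of `L²(ℝ)`. -/
structure WeightState where
  /-- the probabilities `qₙ` -/
  prob : ℕ → ℝ
  /-- the wave functions `φₙ` in the energy representation -/
  wave : ℕ → ℝ → ℂ
  prob_nonneg : ∀ n, 0 ≤ prob n
  hasSum_prob : HasSum prob 1
  memLp_wave : ∀ n, MemLp (wave n) 2 volume
  norm_wave : ∀ n, ∫ E, ‖wave n E‖ ^ 2 = 1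

/-- The matrix element `⟨E₁| ρ_W |E₂⟩`. -/
def WeightState.kernel (ρW : WeightState) (E₁ E₂ : ℝ) : ℂ :=
  ∑' n, (ρW.prob n : ℂ) * ρW.wave n E₁ * star (ρW.wave n E₂)

/-- The energy distribution `f(E) = ⟨E| ρ_W |E⟩`. -/
def WeightState.energyDensity (ρW : WeightState) (E : ℝ) : ℝ :=
  (ρW.kernel E E).re

/-- The Wigner function
`W(E,t) = (1/2π) ∫ dν e^{iνt} Tr[ρ_W |E + ν/2⟩⟨E - ν/2|]`. -/
def WeightState.wigner (ρW : WeightState) (E t : ℝ) : ℂ :=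
  (1 / (2 * Real.pi) : ℂ) *
    ∫ ν : ℝ, Complex.exp (Complex.I * ν * t) * ρW.kernel (E - ν / 2) (E + ν / 2)

/-! ### Mean and variance of an energy distribution -/

/-- `∫ E f(E) dE` -/
def mean (f : ℝ → ℝ) : ℝ := ∫ E, E * f E

/-- `∫ E² f(E) dE - (∫ E f(E) dE)²` -/
def variance (f : ℝ → ℝ) : ℝ := (∫ E, E ^ 2 * f E) - (∫ E, E * f E) ^ 2

/-- The second moment of the distribution exists. -/
def FiniteSecondMoment (f : ℝ → ℝ) : Prop := Integrable fun E => E ^ 2 * f E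

/-! ### The qubit and the composite system

The composite Hilbert space is `ℂ² ⊗ L²(ℝ)`; its vectors are wave functions of the pair `(E, i)`. -/

/-- The energy levels `0` and `ω` of the qubit. -/
def level (ω : ℝ) : Fin 2 → ℝ := ![0, ω]

/-- The qubit Hamiltonian `H_S = ω |1⟩⟨1|`. -/
def hamiltonian (ω : ℝ) : Matrix (Fin 2) (Fin 2) ℂ :=
  Matrix.diagonal fun i => (level ω i : ℂ)

/-- Wave functions of the composite system. -/
abbrev WaveFunction := ℝ × Fin 2 → ℂ

/-- Operator kernels `⟨E₁, i| ρ |E₂, j⟩` on the composite system. -/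
abbrev OpKernel := ℝ × Fin 2 → ℝ × Fin 2 → ℂ

/-- `e^{-i s H_S ⊗ Δ_W}`: as `Δ_W = -i d/dE`, this displaces the energy of the weight by `s ε_i`
if the qubit is in the energy eigenstate `|i⟩`. -/
def controlledShift (ω s : ℝ) (Ψ : WaveFunction) : WaveFunction :=
  fun x => Ψ (x.1 - s * level ω x.2, x.2)

/-- A qubit operator `V_S`, acting on the composite system as `V_S ⊗ 1`. -/
def onQubit (V : Matrix (Fin 2) (Fin 2) ℂ) (Ψ : WaveFunction) : WaveFunction :=
  fun x => ∑ j, V x.2 j * Ψ (x.1, j)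

/-- The operator `S = e^{-i H_S ⊗ Δ_W}`. -/
def opS (ω : ℝ) : WaveFunction → WaveFunction := controlledShift ω 1

/-- The operator `S† = e^{i H_S ⊗ Δ_W}`. -/
def opSDagger (ω : ℝ) : WaveFunction → WaveFunction := controlledShift ω (-1)

/-- The unitary `U = S† V_S S` of a work extraction protocol. -/
def protocolU (ω : ℝ) (V : Matrix (Fin 2) (Fin 2) ℂ) : WaveFunction → WaveFunction :=
  fun Ψ => opSDagger ω (onQubit V (opS ω Ψ))

/-- The kernel of the adjoint `K†`. -/
def adj (K : OpKernel) : OpKernel := fun x y => star (K y x)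

/-- The kernel of `A K`. -/
def mulLeft (A : WaveFunction → WaveFunction) (K : OpKernel) : OpKernel :=
  fun x y => A (fun z => K z y) x

/-- The kernel of `A K A† = (A (A K)†)†`. -/
def conjugate (A : WaveFunction → WaveFunction) (K : OpKernel) : OpKernel :=
  adj (mulLeft A (adj (mulLeft A K)))

/-- The product state `ρ_S ⊗ ρ_W`. -/
def productState (ρS : Matrix (Fin 2) (Fin 2) ℂ) (ρW : WeightState) : OpKernel :=
  fun x y => ρS x.2 y.2 * ρW.kernel x.1 y.1

/-- The energy distribution `∑ᵢ ⟨E, i| ρ |E, i⟩` of the weight in a state of the composite system. -/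
def weightEnergyDensity (K : OpKernel) (E : ℝ) : ℝ := ∑ i, (K (E, i) (E, i)).re

/-- The partial trace over the weight. -/
def traceWeight (K : OpKernel) : Matrix (Fin 2) (Fin 2) ℂ :=
  Matrix.of fun i j => ∫ E, K (E, i) (E, j)

/-- The state `U (ρ_S ⊗ ρ_W) U†` after the protocol. -/
def finalState (ω : ℝ) (ρS : Matrix (Fin 2) (Fin 2) ℂ) (ρW : WeightState)
    (V : Matrix (Fin 2) (Fin 2) ℂ) : OpKernel :=
  conjugate (protocolU ω V) (productState ρS ρW)

/-- The change `ΔE_W` of the average energy of the weight. -/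
def deltaEnergy (ω : ℝ) (ρS : Matrix (Fin 2) (Fin 2) ℂ) (ρW : WeightState)
    (V : Matrix (Fin 2) (Fin 2) ℂ) : ℝ :=
  mean (weightEnergyDensity (finalState ω ρS ρW V)) -
    mean (weightEnergyDensity (productState ρS ρW))

/-- The change `Δσ_W²` of the energy variance of the weight. -/
def deltaVariance (ω : ℝ) (ρS : Matrix (Fin 2) (Fin 2) ℂ) (ρW : WeightState)
    (V : Matrix (Fin 2) (Fin 2) ℂ) : ℝ :=
  variance (weightEnergyDensity (finalState ω ρS ρW V)) -
    variance (weightEnergyDensity (productState ρS ρW))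

/-- The control-marginal state `σ_S = Tr_W[S (ρ_S ⊗ ρ_W) S†]`. -/
def controlMarginal (ω : ℝ) (ρS : Matrix (Fin 2) (Fin 2) ℂ) (ρW : WeightState) :
    Matrix (Fin 2) (Fin 2) ℂ :=
  traceWeight (conjugate (opS ω) (productState ρS ρW))

/-- The projector `|ψ⟩⟨ψ|`. -/
def projector (ψ : EuclideanSpace ℂ (Fin 2)) : Matrix (Fin 2) (Fin 2) ℂ :=
  Matrix.of fun i j => ψ i * star (ψ j)

/-- The dimensionless energy `ε = ⟨ψ| H_S |ψ⟩ / ω`. -/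
def relEnergy (ω : ℝ) (ψ : EuclideanSpace ℂ (Fin 2)) : ℝ :=
  (1 / ω) * (∑ i, ∑ j, star (ψ i) * hamiltonian ω i j * ψ j).re

/-! ### The Wigner integrals and the boundary of the work-variance phase space -/

/-- The integrals `∫ dt ∫ dE E W(E,t) c(t)` with a bounded factor `c(t)` exist. -/
def WeightState.WignerMomentExists (ρW : WeightState) : Prop :=
  (∀ᵐ t : ℝ, Integrable fun E : ℝ => (E : ℂ) * ρW.wigner E t) ∧
    Integrable fun t : ℝ => ∫ E : ℝ, (E : ℂ) * ρW.wigner E t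

/-- `γ = ∫ dt ∫ dE W(E,t) e^{iωt}` -/
def gammaInt (ω : ℝ) (ρW : WeightState) : ℂ :=
  ∫ t : ℝ, ∫ E : ℝ, ρW.wigner E t * Complex.exp (Complex.I * ω * t)

/-- `η = (1/ω) ∫ dt ∫ dE E W(E,t) (e^{iωt}/γ + e^{-iωt}/γ*)` -/
def etaInt (ω : ℝ) (ρW : WeightState) : ℂ :=
  (1 / ω : ℂ) * ∫ t : ℝ, ∫ E : ℝ, (E : ℂ) * ρW.wigner E t *
    (Complex.exp (Complex.I * ω * t) * (1 / gammaInt ω ρW) +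
      Complex.exp (-(Complex.I * ω * t)) * (1 / star (gammaInt ω ρW)))

/-- `ξ = (1/ω) ∫ dt ∫ dE E W(E,t) (e^{iωt} ε₁/γ - e^{-iωt} ε₀/γ*)` -/
def xiInt (ω ε₀ ε₁ : ℝ) (ρW : WeightState) : ℂ :=
  (1 / ω : ℂ) * ∫ t : ℝ, ∫ E : ℝ, (E : ℂ) * ρW.wigner E t *
    (Complex.exp (Complex.I * ω * t) * (ε₁ / gammaInt ω ρW) -
      Complex.exp (-(Complex.I * ω * t)) * (ε₀ / star (gammaInt ω ρW)))

/-- The centre `f(w)` of the range of variance changes. -/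
def fCentre (p ε₀ ε₁ η w : ℝ) : ℝ :=
  -w ^ 2 + ((ε₁ - ε₀) / (1 - 2 * p) + 4 * ε₀ * ε₁ * η) * w +
    2 * ε₀ * ε₁ * (1 - (1 - 2 * p) * (ε₁ - ε₀) * η)

/-- `R = |1 - 2 (1 - 2p) ξ|` -/
def radiusR (p : ℝ) (ξ : ℂ) : ℝ := ‖1 - 2 * (1 - 2 * (p : ℂ)) * ξ‖

/-- The half-width `h(w)` of the range of variance changes. -/
def hWidth (p ε₀ ε₁ : ℝ) (ξ : ℂ) (w : ℝ) : ℝ :=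
  2 * radiusR p ξ *
    Real.sqrt (ε₀ * ε₁ * (ε₀ + w / (1 - 2 * p)) * (ε₁ - w / (1 - 2 * p)))

end QubitWeight

end

/-! After `S` the protocol acts by `V` alone, and `S†` lowers the weight energy by ω exactly when
the qubit ends in |1⟩. Hence `V` enters the first two energy moments only through the (1,1) entries
of V σ V† and V X V†, where X collects the first energy moments after `S`; the remaining terms are
traces, fixed by unitarity (`energy_moments_finalState`). Recentring the off-diagonal kernels
expresses X through σ and a single complex number μ = `relMoment` (`shiftMoment_one_apply`), with η
= μ + μ* and ξ = ε₁μ − ε₀μ*.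

Write ψ₀ = (x₀, x₁), ψ₁ = (y₀, y₁), let A, B be the (bilinear) products of the lower row of `V` with
ψ₀, ψ₁, and put q = |A|², z = A B* x₁* y₁. Then w = (1−2p)(q−ε₀), the variance change is f(w) − 2
Re((1 − 2(1−2p)ξ) z), and |z|² = ε₀ε₁q(1−q) (`phase_space_point`, `norm_coherence_sq`). The number q
runs over [0,1], and the relative phase of A and B is free, so the real part fills the whole
interval of radius R|z| (`exists_unitary_coherence`).

The analytic work identifies γ and μ, defined by Wigner integrals, with integrals of the shifted
kernel (`gammaInt_eq`, `integral_exp_mul_energy_wigner`). A purification a ∈ L²(ℝ; ℓ²) turns W into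
a cross-Wigner function, and E·W is one as well, for a pair built from a and E·a. Its energy
marginal should be the pointwise product of two Fourier transforms, but only iterated integrability
is assumed, so Fubini does not apply directly. A Gaussian cutoff in E makes the exchange legitimate.
On the Fourier side the cutoff is an average over opposite shifts of the two factors, which
converges in L¹ as the cutoff is removed, while the Wigner side converges by domination
(`integral_crossWigner_ae_eq`). -/

noncomputable section

namespace QubitWeight

open scoped FourierTransform InnerProductSpace SchwartzMap ENNReal
open Real (fourierChar)
open Filter Topology

set_option linter.unusedSectionVars false

/-! ### Translations and modulations on L²(ℝ; F) -/

section Translation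

variable {F : Type*} [NormedAddCommGroup F] [InnerProductSpace ℂ F]

/-- The translation `a ↦ a (· + h)` of `L²(ℝ; F)`. -/
def translate (h : ℝ) (a : Lp F 2 (volume : Measure ℝ)) : Lp F 2 (volume : Measure ℝ) :=
  Lp.compMeasurePreserving (· + h) (measurePreserving_add_right volume h) a

lemma coeFn_translate (h : ℝ) (a : Lp F 2 (volume : Measure ℝ)) :
    translate h a =ᵐ[volume] fun x => a (x + h) :=
  Lp.coeFn_compMeasurePreserving _ _

lemma continuous_translate (h : ℝ) :
    Continuous (translate h : Lp F 2 (volume : Measure ℝ) → Lp F 2 (volume : Measure ℝ)) :=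
  (Lp.isometry_compMeasurePreserving _).continuous

lemma norm_translate (h : ℝ) (a : Lp F 2 (volume : Measure ℝ)) : ‖translate h a‖ = ‖a‖ :=
  Lp.norm_compMeasurePreserving _ _

lemma continuous_translate_left (a : Lp F 2 (volume : Measure ℝ)) :
    Continuous fun h => translate h a := by
  let g : ℝ → C(ℝ, ℝ) := fun h => ⟨(· + h), by fun_prop⟩
  have hg : Continuous g := ContinuousMap.continuous_of_continuous_uncurry _ (by
    change Continuous fun p : ℝ × ℝ => p.2 + p.1
    fun_prop)
  exact (continuous_const (y := a)).compMeasurePreservingLp hg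
    (fun h => measurePreserving_add_right volume h) (by simp)

lemma memLp_modulate (h : ℝ) {a : ℝ → F} (ha : MemLp a 2 volume) :
    MemLp (fun x => fourierChar (h * x) • a x) 2 volume := by
  refine ha.of_le_mul (c := 1) ?_ (Filter.Eventually.of_forall fun x => ?_)
  · have : Continuous fun x : ℝ => (fourierChar (h * x) : ℂ) := by fun_prop
    exact this.aestronglyMeasurable.smul ha.1
  · rw [Circle.norm_smul, one_mul]

/-- Multiplication by the character `x ↦ e^{2πihx}` on `L²(ℝ; F)`. -/
def modulate (h : ℝ) (a : Lp F 2 (volume : Measure ℝ)) : Lp F 2 (volume : Measure ℝ) :=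
  (memLp_modulate h (Lp.memLp a)).toLp _

lemma coeFn_modulate (h : ℝ) (a : Lp F 2 (volume : Measure ℝ)) :
    modulate h a =ᵐ[volume] fun x => fourierChar (h * x) • a x :=
  MemLp.coeFn_toLp _

lemma isometry_modulate (h : ℝ) :
    Isometry (modulate h : Lp F 2 (volume : Measure ℝ) → Lp F 2 (volume : Measure ℝ)) := by
  intro a b
  rw [Lp.edist_def, Lp.edist_def]
  refine eLpNorm_congr_norm_ae ?_
  filter_upwards [coeFn_modulate h a, coeFn_modulate h b] with x h1 h2
  simp only [Pi.sub_apply, h1, h2]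
  rw [← smul_sub, Circle.norm_smul]

end Translation

/-! ### The Fourier transform intertwines translation and modulation -/

section Fourier

variable {F : Type*} [NormedAddCommGroup F] [InnerProductSpace ℂ F] [CompleteSpace F]

lemma translate_toLp (h : ℝ) (f : 𝓢(ℝ, F)) :
    translate h (f.toLp 2) = (f.compSubConstCLM ℂ (-h)).toLp 2 := by
  apply Lp.ext
  have h1 := (measurePreserving_add_right (volume : Measure ℝ) h).quasiMeasurePreserving.ae
    (f.coeFn_toLp 2 volume)
  filter_upwards [coeFn_translate h (f.toLp 2), (f.compSubConstCLM ℂ (-h)).coeFn_toLp 2 volume,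
    h1] with x h2 h3 h4
  rw [h2, h3, h4]
  simp

lemma fourier_compSubConst (h s : ℝ) (f : 𝓢(ℝ, F)) :
    𝓕 (f.compSubConstCLM ℂ (-h)) s = fourierChar (h * s) • 𝓕 f s := by
  rw [SchwartzMap.fourier_coe, SchwartzMap.fourier_coe, Real.fourier_real_eq, Real.fourier_real_eq,
    ← integral_add_right_eq_self (fun x => fourierChar (-(x * s)) • f x) h, Circle.smul_def,
    ← integral_smul]
  congr 1 with x
  rw [← Circle.smul_def, smul_smul, ← AddChar.map_add_eq_mul]
  simp only [SchwartzMap.compSubConstCLM_apply, sub_neg_eq_add]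
  congr 2
  ring

lemma fourierInv_compSubConst (h s : ℝ) (f : 𝓢(ℝ, F)) :
    𝓕⁻ (f.compSubConstCLM ℂ (-h)) s = fourierChar (-h * s) • 𝓕⁻ f s := by
  rw [SchwartzMap.fourierInv_coe, SchwartzMap.fourierInv_coe, Real.fourierInv_eq_fourier_neg,
    Real.fourierInv_eq_fourier_neg, ← SchwartzMap.fourier_coe, ← SchwartzMap.fourier_coe,
    fourier_compSubConst]
  congr 2
  ring

/-- The Fourier transform turns translations into modulations. -/
theorem fourier_translate (h : ℝ) (a : Lp F 2 (volume : Measure ℝ)) :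
    𝓕 (translate h a) = modulate h (𝓕 a) := by
  have hd : DenseRange (SchwartzMap.toLpCLM ℂ (E := ℝ) F 2 volume) :=
    SchwartzMap.denseRange_toLpCLM ENNReal.ofNat_ne_top
  refine hd.induction_on (p := fun a => 𝓕 (translate h a) = modulate h (𝓕 a)) a
    (isClosed_eq ?_ ?_) ?_
  · exact (Lp.fourierTransformₗᵢ ℝ F).continuous.comp (continuous_translate h)
  · exact (isometry_modulate h).continuous.comp (Lp.fourierTransformₗᵢ ℝ F).continuous
  · intro f
    rw [SchwartzMap.toLpCLM_apply, translate_toLp, SchwartzMap.toLp_fourier_eq,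
      SchwartzMap.toLp_fourier_eq]
    apply Lp.ext
    filter_upwards [(𝓕 (f.compSubConstCLM ℂ (-h))).coeFn_toLp 2 volume,
      (𝓕 f).coeFn_toLp 2 volume, coeFn_modulate h ((𝓕 f).toLp 2)] with x h1 h2 h3
    rw [h1, h3, h2, fourier_compSubConst]

/-- The inverse Fourier transform turns translations into modulations. -/
theorem fourierInv_translate (h : ℝ) (a : Lp F 2 (volume : Measure ℝ)) :
    𝓕⁻ (translate h a) = modulate (-h) (𝓕⁻ a) := by
  have hd : DenseRange (SchwartzMap.toLpCLM ℂ (E := ℝ) F 2 volume) :=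
    SchwartzMap.denseRange_toLpCLM ENNReal.ofNat_ne_top
  refine hd.induction_on (p := fun a => 𝓕⁻ (translate h a) = modulate (-h) (𝓕⁻ a)) a
    (isClosed_eq ?_ ?_) ?_
  · exact (Lp.fourierTransformₗᵢ ℝ F).symm.continuous.comp (continuous_translate h)
  · exact (isometry_modulate (-h)).continuous.comp (Lp.fourierTransformₗᵢ ℝ F).symm.continuous
  · intro f
    rw [SchwartzMap.toLpCLM_apply, translate_toLp, SchwartzMap.toLp_fourierInv_eq,
      SchwartzMap.toLp_fourierInv_eq]
    apply Lp.ext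
    filter_upwards [(𝓕⁻ (f.compSubConstCLM ℂ (-h))).coeFn_toLp 2 volume,
      (𝓕⁻ f).coeFn_toLp 2 volume, coeFn_modulate (-h) ((𝓕⁻ f).toLp 2)] with x h1 h2 h3
    rw [h1, h3, h2, fourierInv_compSubConst]

lemma translate_fourier (h : ℝ) (a : Lp F 2 (volume : Measure ℝ)) :
    translate h (𝓕 a) = 𝓕 (modulate (-h) a) := by
  refine (Lp.fourierTransformₗᵢ ℝ F).symm.injective ?_
  change 𝓕⁻ (translate h (𝓕 a)) = 𝓕⁻ (𝓕 (modulate (-h) a))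
  rw [fourierInv_translate, FourierTransform.fourierInv_fourier_eq (F := Lp F 2 volume),
    FourierTransform.fourierInv_fourier_eq (F := Lp F 2 volume)]

/-- The cross-correlation of two Fourier transforms, with a phase, in terms of the original
functions. -/
theorem integral_fourierChar_inner_fourier (a b : Lp F 2 (volume : Measure ℝ)) (h ν : ℝ) :
    ∫ s, fourierChar (-(s * ν)) • ⟪translate h (𝓕 b) s, translate (-h) (𝓕 a) s⟫_ℂ =
      ∫ x, fourierChar (2 * h * x) • ⟪b (x + ν / 2), a (x - ν / 2)⟫_ℂ := by
  -- The phase in ν is split evenly between the two factors; Parseval then turns it into shifts by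
  -- ±ν/2, and the shifts ±h into one character of frequency 2h.
  have key : ⟪translate h (modulate (ν / 2) (𝓕 b)), translate (-h) (modulate (-(ν / 2)) (𝓕 a))⟫_ℂ =
      ⟪modulate (-h) (translate (ν / 2) b), modulate h (translate (-(ν / 2)) a)⟫_ℂ := by
    rw [← fourier_translate, ← fourier_translate, translate_fourier, translate_fourier,
      Lp.inner_fourier_eq, neg_neg]
  rw [L2.inner_def, L2.inner_def] at key
  have hmul : ∀ (c d : Circle) (u v : F), ⟪c • u, d • v⟫_ℂ = (c⁻¹ * d) • ⟪u, v⟫_ℂ := by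
    intro c d u v
    simp only [Circle.smul_def, inner_smul_left, inner_smul_right, Circle.coe_mul,
      Circle.coe_inv_eq_conj, smul_eq_mul]
    ring
  convert key using 1
  · refine integral_congr_ae ?_
    have qp : ∀ k : ℝ, Measure.QuasiMeasurePreserving (fun x : ℝ => x + k) volume volume :=
      fun k => (measurePreserving_add_right (volume : Measure ℝ) k).quasiMeasurePreserving
    filter_upwards [coeFn_translate h (𝓕 b), coeFn_translate (-h) (𝓕 a),
      coeFn_translate h (modulate (ν / 2) (𝓕 b)),
      coeFn_translate (-h) (modulate (-(ν / 2)) (𝓕 a)),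
      (qp h).ae (coeFn_modulate (ν / 2) (𝓕 b)),
      (qp (-h)).ae (coeFn_modulate (-(ν / 2)) (𝓕 a))] with s h1 h2 h3 h4 h5 h6
    rw [h1, h2, h3, h4, h5, h6, hmul, ← AddChar.map_neg_eq_inv, ← AddChar.map_add_eq_mul]
    congr 2
    ring
  · refine integral_congr_ae ?_
    filter_upwards [coeFn_translate (ν / 2) b, coeFn_translate (-(ν / 2)) a,
      coeFn_modulate (-h) (translate (ν / 2) b),
      coeFn_modulate h (translate (-(ν / 2)) a)] with s h1 h2 h3 h4
    rw [h3, h4, h1, h2, hmul, ← AddChar.map_neg_eq_inv, ← AddChar.map_add_eq_mul, ← sub_eq_add_neg]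
    congr 2
    ring

end Fourier

/-! ### Fourier inversion for integrable functions -/

section Inversion

lemma integral_fourier_smul_eq_of_integrable {f g : ℝ → ℂ} (hf : Integrable f)
    (hg : Integrable g) : ∫ x, 𝓕 f x * g x = ∫ x, f x * 𝓕 g x := by
  have h := VectorFourier.integral_bilin_fourierIntegral_eq_flip (μ := volume) (ν := volume)
    (L := innerₗ ℝ) (ContinuousLinearMap.mul ℂ ℂ) Real.continuous_fourierChar
    (by exact continuous_inner) hf hg
  simp only [flip_innerₗ] at h
  exact h

/-- Fourier inversion almost everywhere. -/
theorem ae_eq_fourierInv_of_fourier_eq {g K : ℝ → ℂ} (hg : Integrable g) (hK : Integrable K)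
    (h : ∀ ν, 𝓕 g ν = K ν) : g =ᵐ[volume] 𝓕⁻ K := by
  have hcont : Continuous (𝓕⁻ K) := by
    rw [Real.fourierInv_eq_fourier_comp_neg]
    exact VectorFourier.fourierIntegral_continuous Real.continuous_fourierChar
      (by exact continuous_inner) hK.comp_neg
  -- Both sides are tested against smooth compactly supported ψ; such a ψ is Schwartz, so ψ = 𝓕𝓕⁻ψ
  -- and the transform can be moved onto g or K.
  refine ae_eq_of_integral_contDiff_smul_eq hg.locallyIntegrable hcont.locallyIntegrable ?_
  intro ψ hψ hψs
  have hs : HasCompactSupport (fun x => (ψ x : ℂ)) := hψs.comp_left (g := fun y : ℝ => (y : ℂ)) rfl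
  let Ψ : 𝓢(ℝ, ℂ) := hs.toSchwartzMap (Complex.ofRealCLM.contDiff.comp hψ)
  have hΨ : ∀ x, Ψ x = ψ x := fun x => rfl
  simp only [Complex.real_smul, ← hΨ]
  have e1 : ∫ x, Ψ x * g x = ∫ x, 𝓕⁻ Ψ x * K x := by
    have := integral_fourier_smul_eq_of_integrable (𝓕⁻ Ψ).integrable hg
    rw [← SchwartzMap.fourier_coe, FourierTransform.fourier_fourierInv_eq] at this
    simpa only [h] using this
  have e2 : ∫ x, Ψ x * 𝓕⁻ K x = ∫ x, 𝓕⁻ Ψ x * K x := by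
    rw [Real.fourierInv_eq_fourier_comp_neg,
      ← integral_fourier_smul_eq_of_integrable Ψ.integrable hK.comp_neg,
      ← integral_neg_eq_self]
    simp only [neg_neg]
    rfl
  rw [e1, e2]

end Inversion

/-! ### The cross-spectrum and its Gaussian smoothing -/

section Cross

variable {F : Type*} [NormedAddCommGroup F] [InnerProductSpace ℂ F] [CompleteSpace F]

variable (F) in
/-- The inner product as a real bilinear map. -/
def innerBilin : F →L[ℝ] F →L[ℝ] ℂ :=
  (isBoundedBilinearMap_inner (𝕜 := ℂ) (E := F)).toContinuousLinearMap

variable (F) in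
/-- The pairing `(b, a) ↦ ⟪b(·), a(·)⟫` from `L² × L²` to `L¹`. -/
def innerLp : Lp F 2 (volume : Measure ℝ) →L[ℝ] Lp F 2 (volume : Measure ℝ) →L[ℝ]
    Lp ℂ 1 (volume : Measure ℝ) :=
  (innerBilin F).holderL volume 2 2 1

lemma coeFn_innerLp (b a : Lp F 2 (volume : Measure ℝ)) :
    innerLp F b a =ᵐ[volume] fun x => ⟪b x, a x⟫_ℂ :=
  ContinuousLinearMap.coeFn_holder _ _ _

/-- The `L¹` function `s ↦ ⟪(𝓕 b)(s + h), (𝓕 a)(s - h)⟫`. -/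
def crossSpectrum (a b : Lp F 2 (volume : Measure ℝ)) (h : ℝ) : Lp ℂ 1 (volume : Measure ℝ) :=
  innerLp F (translate h (𝓕 b)) (translate (-h) (𝓕 a))

lemma continuous_crossSpectrum (a b : Lp F 2 (volume : Measure ℝ)) :
    Continuous (crossSpectrum a b) := by
  have h1 := continuous_translate_left (𝓕 b)
  have h2 := (continuous_translate_left (𝓕 a)).comp continuous_neg
  exact ((innerLp F).continuous.comp h1).clm_apply h2

/-- Uniformity in the shift is what allows averaging over shifts and dominated convergence in L¹. -/
lemma norm_crossSpectrum_le (a b : Lp F 2 (volume : Measure ℝ)) (h : ℝ) :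
    ‖crossSpectrum a b h‖ ≤ ‖innerBilin F‖ * ‖b‖ * ‖a‖ := by
  refine ((innerBilin F).norm_holder_apply_apply_le _ _).trans ?_
  rw [norm_translate, norm_translate, Lp.norm_fourier_eq, Lp.norm_fourier_eq]

/-- The shift h appears only as a character of the energy x, so averaging over h amounts to
multiplying by a function of x. -/
lemma fourier_crossSpectrum (a b : Lp F 2 (volume : Measure ℝ)) (h ν : ℝ) :
    𝓕 (crossSpectrum a b h : ℝ → ℂ) ν =
      ∫ x, fourierChar (2 * h * x) • ⟪b (x + ν / 2), a (x - ν / 2)⟫_ℂ := by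
  rw [← integral_fourierChar_inner_fourier, Real.fourier_real_eq]
  refine integral_congr_ae ?_
  filter_upwards [coeFn_innerLp (translate h (𝓕 b)) (translate (-h) (𝓕 a))] with s hs
  rw [crossSpectrum, hs]

/-- The weight `e^{-πτ²}`. -/
def gaussianWeight (τ : ℝ) : ℝ := Real.exp (-Real.pi * τ ^ 2)

lemma integrable_gaussianWeight : Integrable gaussianWeight :=
  integrable_exp_neg_mul_sq Real.pi_pos

lemma integral_gaussianWeight : ∫ τ, gaussianWeight τ = 1 := by
  have := integral_gaussian Real.pi
  rwa [div_self Real.pi_ne_zero, Real.sqrt_one] at this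

lemma gaussianWeight_nonneg (τ : ℝ) : 0 ≤ gaussianWeight τ := (Real.exp_pos _).le

lemma gaussianWeight_le_one (τ : ℝ) : gaussianWeight τ ≤ 1 := by
  rw [gaussianWeight, Real.exp_le_one_iff]
  have := Real.pi_pos
  nlinarith [sq_nonneg τ, mul_nonneg this.le (sq_nonneg τ)]

lemma continuous_gaussianWeight : Continuous gaussianWeight := by
  unfold gaussianWeight
  fun_prop

/-- The Gaussian is its own Fourier transform: the same function serves as averaging kernel over
shifts and as energy cutoff. -/
lemma integral_gaussianWeight_fourierChar (y : ℝ) :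
    ∫ τ, (gaussianWeight τ : ℂ) * (fourierChar (y * τ) : ℂ) = gaussianWeight y := by
  have h := congrFun (fourier_gaussian_pi (b := 1) (by simp)) (-y)
  rw [Real.fourier_real_eq] at h
  simp only [Circle.smul_def, smul_eq_mul] at h
  convert h using 1
  · congr 1 with τ
    rw [gaussianWeight, mul_comm]
    push_cast
    congr 3 <;> ring_nf
  · rw [gaussianWeight]
    push_cast
    simp

/-- The smoothing of `crossSpectrum a b` at scale `ε`. -/
def smoothSpectrum (a b : Lp F 2 (volume : Measure ℝ)) (ε : ℝ) : Lp ℂ 1 (volume : Measure ℝ) :=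
  ∫ τ, gaussianWeight τ • crossSpectrum a b (ε * τ)

lemma integrable_smoothSpectrum (a b : Lp F 2 (volume : Measure ℝ)) (ε : ℝ) :
    Integrable fun τ => gaussianWeight τ • crossSpectrum a b (ε * τ) := by
  refine integrable_gaussianWeight.smul_bdd (C := ‖innerBilin F‖ * ‖b‖ * ‖a‖) ?_ ?_
  · exact ((continuous_crossSpectrum a b).comp (by fun_prop)).aestronglyMeasurable
  · exact Eventually.of_forall fun τ => norm_crossSpectrum_le a b _

/-- An approximate identity argument: the shifted spectrum is continuous in the shift as an
L¹-valued map and uniformly bounded. -/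
lemma tendsto_smoothSpectrum (a b : Lp F 2 (volume : Measure ℝ)) {ε : ℕ → ℝ}
    (hε : Tendsto ε atTop (𝓝 0)) :
    Tendsto (fun n => smoothSpectrum a b (ε n)) atTop (𝓝 (crossSpectrum a b 0)) := by
  have hlim : crossSpectrum a b 0 = ∫ τ, gaussianWeight τ • crossSpectrum a b 0 := by
    rw [integral_smul_const, integral_gaussianWeight, one_smul]
  rw [hlim]
  refine tendsto_integral_of_dominated_convergence
    (fun τ => gaussianWeight τ * (‖innerBilin F‖ * ‖b‖ * ‖a‖)) ?_
    (integrable_gaussianWeight.mul_const _) ?_ ?_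
  · exact fun n => (integrable_smoothSpectrum a b (ε n)).1
  · intro n
    refine Eventually.of_forall fun τ => ?_
    rw [norm_smul, Real.norm_of_nonneg (gaussianWeight_nonneg τ)]
    exact mul_le_mul_of_nonneg_left (norm_crossSpectrum_le a b _) (gaussianWeight_nonneg τ)
  · refine Eventually.of_forall fun τ => ?_
    refine Tendsto.const_smul ?_ _
    refine ((continuous_crossSpectrum a b).tendsto 0).comp ?_
    simpa using hε.mul_const τ

lemma integrable_inner_shift (a b : Lp F 2 (volume : Measure ℝ)) (y y' : ℝ) :
    Integrable fun x => ⟪b (x + y), a (x + y')⟫_ℂ := by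
  have hb := (Lp.memLp b).comp_measurePreserving (measurePreserving_add_right volume y)
  have ha := (Lp.memLp a).comp_measurePreserving (measurePreserving_add_right volume y')
  have := L2.integrable_inner (𝕜 := ℂ) hb.toLp ha.toLp
  refine this.congr ?_
  filter_upwards [hb.coeFn_toLp, ha.coeFn_toLp] with x h1 h2
  rw [h1, h2]
  rfl

/-- The kernel `⟪b(E + ν/2), a(E - ν/2)⟫` integrated over `E` against a Gaussian. -/
def smoothCorrelation (a b : Lp F 2 (volume : Measure ℝ)) (ε ν : ℝ) : ℂ :=
  ∫ x, (gaussianWeight (2 * ε * x) : ℂ) * ⟪b (x + ν / 2), a (x - ν / 2)⟫_ℂ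

/-- Evaluating the transform at ν is a bounded functional on L¹, hence commutes with the Bochner
average; Fubini and the self-dual Gaussian do the rest. -/
lemma fourier_smoothSpectrum (a b : Lp F 2 (volume : Measure ℝ)) (ε ν : ℝ) :
    𝓕 (smoothSpectrum a b ε : ℝ → ℂ) ν = smoothCorrelation a b ε ν := by
  let T : Lp ℂ 1 (volume : Measure ℝ) →L[ℂ] ℂ :=
    (BoundedContinuousFunction.evalCLM ℂ ν).comp (Real.Lp.fourierTransformCLM ℝ ℂ)
  have hT : ∀ f : Lp ℂ 1 (volume : Measure ℝ), T f = 𝓕 (f : ℝ → ℂ) ν := fun f => rfl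
  rw [← hT, smoothSpectrum, ← T.integral_comp_comm (integrable_smoothSpectrum a b ε)]
  have hk : Integrable fun x => ⟪b (x + ν / 2), a (x - ν / 2)⟫_ℂ := by
    simpa only [sub_eq_add_neg] using integrable_inner_shift a b (ν / 2) (-(ν / 2))
  have h1 : ∀ τ, T (gaussianWeight τ • crossSpectrum a b (ε * τ)) =
      ∫ x, (gaussianWeight τ : ℂ) * ((fourierChar (2 * ε * x * τ) : ℂ) *
        ⟪b (x + ν / 2), a (x - ν / 2)⟫_ℂ) := by
    intro τ
    rw [T.map_smul_of_tower, hT, fourier_crossSpectrum, integral_const_mul, Complex.real_smul]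
    congr 2 with x
    rw [Circle.smul_def, smul_eq_mul]
    rw [show 2 * (ε * τ) * x = 2 * ε * x * τ by ring]
  simp only [h1]
  rw [integral_integral_swap]
  · rw [smoothCorrelation]
    congr 1 with x
    rw [← integral_gaussianWeight_fourierChar, ← integral_mul_const]
    simp only [mul_assoc]
  · have hp : Integrable (fun z : ℝ × ℝ => (gaussianWeight z.1 : ℂ) *
        ⟪b (z.2 + ν / 2), a (z.2 - ν / 2)⟫_ℂ) (volume.prod volume) :=
      (integrable_gaussianWeight.ofReal (𝕜 := ℂ)).mul_prod hk
    refine (hp.bdd_mul (c := 1) (f := fun z : ℝ × ℝ => (fourierChar (2 * ε * z.2 * z.1) : ℂ))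
      ?_ ?_).congr ?_
    · exact (by fun_prop : Continuous fun z : ℝ × ℝ =>
        (fourierChar (2 * ε * z.2 * z.1) : ℂ)).aestronglyMeasurable
    · exact Eventually.of_forall fun z => (Circle.norm_coe _).le
    · refine Eventually.of_forall fun z => ?_
      simp only [Function.uncurry]
      ring

end Cross

/-! ### Energy marginals of cross-Wigner functions -/

section CrossWigner

variable {F : Type*} [NormedAddCommGroup F] [InnerProductSpace ℂ F] [CompleteSpace F]

lemma integrable_norm_sq_Lp (a : Lp F 2 (volume : Measure ℝ)) :
    Integrable fun x => ‖a x‖ ^ 2 :=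
  (memLp_two_iff_integrable_sq_norm (Lp.memLp a).1).1 (Lp.memLp a)

lemma integrable_norm_sq_add (b : Lp F 2 (volume : Measure ℝ)) (E : ℝ) :
    Integrable fun ν : ℝ => ‖b (E + ν / 2)‖ ^ 2 :=
  (((integrable_norm_sq_Lp b).comp_add_left E).comp_div two_ne_zero)

lemma integrable_norm_sq_sub (a : Lp F 2 (volume : Measure ℝ)) (E : ℝ) :
    Integrable fun ν : ℝ => ‖a (E - ν / 2)‖ ^ 2 :=
  (((integrable_norm_sq_Lp a).comp_sub_left E).comp_div two_ne_zero)

lemma stronglyMeasurable_inner_prod (a b : Lp F 2 (volume : Measure ℝ)) :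
    StronglyMeasurable fun z : ℝ × ℝ => ⟪b (z.1 + z.2 / 2), a (z.1 - z.2 / 2)⟫_ℂ :=
  ((Lp.stronglyMeasurable b).comp_measurable (by fun_prop)).inner
    ((Lp.stronglyMeasurable a).comp_measurable (by fun_prop))

lemma norm_inner_le_sq_add_sq (x y : F) : ‖⟪x, y⟫_ℂ‖ ≤ ‖x‖ ^ 2 + ‖y‖ ^ 2 :=
  (norm_inner_le_norm x y).trans (by nlinarith [sq_nonneg (‖x‖ - ‖y‖), sq_nonneg (‖x‖ + ‖y‖)])

lemma integrable_inner_mid (a b : Lp F 2 (volume : Measure ℝ)) (E : ℝ) :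
    Integrable fun ν : ℝ => ⟪b (E + ν / 2), a (E - ν / 2)⟫_ℂ := by
  refine ((integrable_norm_sq_add b E).add (integrable_norm_sq_sub a E)).mono' ?_
    (Eventually.of_forall fun ν => norm_inner_le_sq_add_sq _ _)
  exact ((stronglyMeasurable_inner_prod a b).comp_measurable
    (measurable_prodMk_left (x := E))).aestronglyMeasurable

lemma integral_norm_inner_mid_le (a b : Lp F 2 (volume : Measure ℝ)) (E : ℝ) :
    ∫ ν : ℝ, ‖⟪b (E + ν / 2), a (E - ν / 2)⟫_ℂ‖ ≤
      2 * ((∫ x, ‖b x‖ ^ 2) + ∫ x, ‖a x‖ ^ 2) := by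
  refine (integral_mono (integrable_inner_mid a b E).norm
    ((integrable_norm_sq_add b E).add (integrable_norm_sq_sub a E))
    fun ν => norm_inner_le_sq_add_sq _ _).trans ?_
  simp only [Pi.add_apply]
  rw [integral_add (integrable_norm_sq_add b E) (integrable_norm_sq_sub a E),
    Measure.integral_comp_div (fun y => ‖b (E + y)‖ ^ 2) 2,
    Measure.integral_comp_div (fun y => ‖a (E - y)‖ ^ 2) 2,
    integral_add_left_eq_self (fun y => ‖b y‖ ^ 2) E,
    integral_sub_left_eq_self (fun y => ‖a y‖ ^ 2) volume E]
  simp only [abs_two, smul_eq_mul]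
  linarith

/-- The ν-integral of the norm is bounded uniformly in E but need not be integrable in E; the cutoff
supplies the missing decay and so legitimises Fubini. -/
lemma integrable_gaussianWeight_inner_prod (a b : Lp F 2 (volume : Measure ℝ)) {ε : ℝ}
    (hε : ε ≠ 0) :
    Integrable (fun z : ℝ × ℝ => (gaussianWeight (2 * ε * z.1) : ℂ) *
      ⟪b (z.1 + z.2 / 2), a (z.1 - z.2 / 2)⟫_ℂ) (volume.prod volume) := by
  have hg : Continuous fun x : ℝ => (gaussianWeight (2 * ε * x) : ℂ) :=
    Complex.continuous_ofReal.comp (continuous_gaussianWeight.comp (by fun_prop))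
  have hm : StronglyMeasurable (fun z : ℝ × ℝ => (gaussianWeight (2 * ε * z.1) : ℂ) *
      ⟪b (z.1 + z.2 / 2), a (z.1 - z.2 / 2)⟫_ℂ) :=
    (hg.comp continuous_fst).stronglyMeasurable.mul (stronglyMeasurable_inner_prod a b)
  refine (integrable_prod_iff hm.aestronglyMeasurable).2 ⟨?_, ?_⟩
  · exact Eventually.of_forall fun E =>
      (integrable_inner_mid a b E).const_mul (gaussianWeight (2 * ε * E) : ℂ)
  · have hgi : Integrable fun x : ℝ => gaussianWeight (2 * ε * x) :=
      integrable_gaussianWeight.comp_mul_left' (mul_ne_zero two_ne_zero hε)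
    refine (hgi.mul_const (2 * ((∫ x, ‖b x‖ ^ 2) + ∫ x, ‖a x‖ ^ 2))).mono'
      hm.norm.integral_prod_right'.aestronglyMeasurable (Eventually.of_forall fun E => ?_)
    rw [Real.norm_of_nonneg (integral_nonneg fun _ => norm_nonneg _)]
    simp only [norm_mul, Complex.norm_real, Real.norm_of_nonneg (gaussianWeight_nonneg _)]
    rw [integral_const_mul]
    exact mul_le_mul_of_nonneg_left (integral_norm_inner_mid_le a b E) (gaussianWeight_nonneg _)

/-- The cross-Wigner function of two square-integrable functions, with frequency normalised as in
the Fourier transform `𝓕`. -/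
def crossWigner (a b : Lp F 2 (volume : Measure ℝ)) (E s : ℝ) : ℂ :=
  ∫ ν, fourierChar (ν * s) • ⟪b (E + ν / 2), a (E - ν / 2)⟫_ℂ

lemma fourierInv_smoothCorrelation (a b : Lp F 2 (volume : Measure ℝ)) {ε : ℝ} (hε : ε ≠ 0)
    (s : ℝ) :
    𝓕⁻ (smoothCorrelation a b ε) s =
      ∫ E, (gaussianWeight (2 * ε * E) : ℂ) * crossWigner a b E s := by
  rw [Real.fourierInv_eq]
  have h1 : ∀ ν : ℝ, fourierChar (inner ℝ ν s) • smoothCorrelation a b ε ν =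
      ∫ E, (fourierChar (ν * s) : ℂ) * ((gaussianWeight (2 * ε * E) : ℂ) *
        ⟪b (E + ν / 2), a (E - ν / 2)⟫_ℂ) := by
    intro ν
    rw [integral_const_mul, Circle.smul_def, smul_eq_mul, smoothCorrelation]
    congr 3
    simp [mul_comm]
  simp only [h1]
  rw [← integral_integral_swap]
  · congr 1 with E
    rw [crossWigner, ← integral_const_mul]
    congr 1 with ν
    rw [Circle.smul_def, smul_eq_mul]
    ring
  · refine ((integrable_gaussianWeight_inner_prod a b hε).bdd_mul (c := 1)
      (f := fun z : ℝ × ℝ => (fourierChar (z.2 * s) : ℂ)) ?_ ?_)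
    · exact (by fun_prop : Continuous fun z : ℝ × ℝ =>
        (fourierChar (z.2 * s) : ℂ)).aestronglyMeasurable
    · exact Eventually.of_forall fun z => (Circle.norm_coe _).le

lemma integrable_smoothCorrelation (a b : Lp F 2 (volume : Measure ℝ)) {ε : ℝ} (hε : ε ≠ 0) :
    Integrable (smoothCorrelation a b ε) :=
  (integrable_gaussianWeight_inner_prod a b hε).integral_prod_right

lemma smoothSpectrum_ae_eq (a b : Lp F 2 (volume : Measure ℝ)) {ε : ℝ} (hε : ε ≠ 0) :
    smoothSpectrum a b ε =ᵐ[volume]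
      fun s => ∫ E, (gaussianWeight (2 * ε * E) : ℂ) * crossWigner a b E s := by
  have h := ae_eq_fourierInv_of_fourier_eq (L1.integrable_coeFn (smoothSpectrum a b ε))
    (integrable_smoothCorrelation a b hε) (fourier_smoothSpectrum a b ε)
  filter_upwards [h] with s hs
  rw [hs, fourierInv_smoothCorrelation a b hε]

/-- If the cross-Wigner function is integrable over the energy, for almost every time, its marginal
is the product of the Fourier transforms. -/
theorem integral_crossWigner_ae_eq (a b : Lp F 2 (volume : Measure ℝ))
    (hw : ∀ᵐ s, Integrable fun E => crossWigner a b E s) :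
    (fun s => ∫ E, crossWigner a b E s) =ᵐ[volume] crossSpectrum a b 0 := by
  let ε : ℕ → ℝ := fun n => 1 / ((n : ℝ) + 1)
  have hε0 : ∀ n, ε n ≠ 0 := fun n => Nat.one_div_pos_of_nat.ne'
  have hε : Tendsto ε atTop (𝓝 0) := tendsto_one_div_add_atTop_nhds_zero_nat
  -- L¹ convergence gives convergence in measure, hence almost everywhere along a subsequence; there
  -- the limit is compared with the one from dominated convergence.
  obtain ⟨ns, hns, hlim⟩ := (tendstoInMeasure_of_tendsto_Lp
    (tendsto_smoothSpectrum a b hε)).exists_seq_tendsto_ae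
  have hall : ∀ᵐ s, ∀ n, smoothSpectrum a b (ε n) s =
      ∫ E, (gaussianWeight (2 * ε n * E) : ℂ) * crossWigner a b E s :=
    ae_all_iff.2 fun n => smoothSpectrum_ae_eq a b (hε0 n)
  filter_upwards [hlim, hall, hw] with s h1 h2 h3
  refine tendsto_nhds_unique ?_ h1
  simp only [h2]
  refine tendsto_integral_of_dominated_convergence (fun E => ‖crossWigner a b E s‖) ?_ h3.norm ?_ ?_
  · intro n
    refine Continuous.aestronglyMeasurable ?_ |>.mul h3.1
    exact Complex.continuous_ofReal.comp (continuous_gaussianWeight.comp (by fun_prop))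
  · intro n
    refine Eventually.of_forall fun E => ?_
    rw [norm_mul, Complex.norm_real, Real.norm_of_nonneg (gaussianWeight_nonneg _)]
    exact mul_le_of_le_one_left (norm_nonneg _) (gaussianWeight_le_one _)
  · refine Eventually.of_forall fun E => ?_
    have hc : Tendsto (fun n => (gaussianWeight (2 * ε (ns n) * E) : ℂ)) atTop (𝓝 1) := by
      have h0 : Tendsto (fun n => 2 * ε (ns n) * E) atTop (𝓝 0) := by
        simpa using ((hε.comp hns.tendsto_atTop).const_mul 2).mul_const E
      have := (Complex.continuous_ofReal.comp continuous_gaussianWeight).tendsto 0 |>.comp h0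
      simpa [gaussianWeight, Function.comp_def] using this
    simpa using hc.mul_const (crossWigner a b E s)

/-- The Fourier transform of the marginal of the cross-Wigner function is the correlation
function. -/
theorem integral_fourierChar_integral_crossWigner (a b : Lp F 2 (volume : Measure ℝ))
    (hw : ∀ᵐ s, Integrable fun E => crossWigner a b E s) (ν : ℝ) :
    ∫ s, (fourierChar (s * ν) : ℂ) * ∫ E, crossWigner a b E s =
      ∫ x, ⟪b (x - ν / 2), a (x + ν / 2)⟫_ℂ := by
  -- The argument −ν compensates for the negative sign in the exponent of 𝓕.
  have h := fourier_crossSpectrum a b 0 (-ν)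
  rw [← Real.fourier_congr_ae (integral_crossWigner_ae_eq a b hw), Real.fourier_real_eq] at h
  simpa [Circle.smul_def, neg_div, ← sub_eq_add_neg] using h

end CrossWigner

/-! ### Purification of the state of the weight -/

section Purification

/-- The auxiliary Hilbert space `ℓ²(ℕ)` of a purification of the state of the weight. -/
abbrev AuxSpace := lp (fun _ : ℕ => ℂ) 2

namespace WeightState

variable (ρW : WeightState)

/-- The components `√qₙ φₙ(E)` of the purified wave function. -/
def amplitude (E : ℝ) (n : ℕ) : ℂ := (Real.sqrt (ρW.prob n) : ℂ) * ρW.wave n E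

lemma norm_amplitude_sq (E : ℝ) (n : ℕ) :
    ‖ρW.amplitude E n‖ ^ 2 = ρW.prob n * ‖ρW.wave n E‖ ^ 2 := by
  rw [amplitude, norm_mul, mul_pow, Complex.norm_real, Real.norm_of_nonneg (Real.sqrt_nonneg _),
    Real.sq_sqrt (ρW.prob_nonneg n)]

lemma aestronglyMeasurable_amplitude (n : ℕ) :
    AEStronglyMeasurable (fun E => ρW.amplitude E n) volume :=
  (ρW.memLp_wave n).1.const_mul _

lemma integral_norm_amplitude_sq (n : ℕ) : ∫ E, ‖ρW.amplitude E n‖ ^ 2 = ρW.prob n := by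
  simp only [norm_amplitude_sq]
  rw [integral_const_mul, ρW.norm_wave, mul_one]

lemma integrable_norm_amplitude_sq (n : ℕ) : Integrable fun E => ‖ρW.amplitude E n‖ ^ 2 :=
  (memLp_two_iff_integrable_sq_norm (ρW.aestronglyMeasurable_amplitude n)).1
    ((ρW.memLp_wave n).const_mul _)

/-- By Tonelli the total mass is ∑ qₙ = 1; finiteness puts almost every fibre in ℓ². -/
lemma lintegral_tsum_amplitude :
    ∫⁻ E, ∑' n, ENNReal.ofReal (‖ρW.amplitude E n‖ ^ 2) ≠ ∞ := by
  rw [lintegral_tsum fun n => (ρW.integrable_norm_amplitude_sq n).1.aemeasurable.ennreal_ofReal]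
  have h : ∀ n, ∫⁻ E, ENNReal.ofReal (‖ρW.amplitude E n‖ ^ 2) = ENNReal.ofReal (ρW.prob n) := by
    intro n
    rw [← ofReal_integral_eq_lintegral_ofReal (ρW.integrable_norm_amplitude_sq n)
      (Eventually.of_forall fun E => sq_nonneg _), integral_norm_amplitude_sq]
  simp only [h]
  exact ρW.hasSum_prob.summable.tsum_ofReal_ne_top

lemma aemeasurable_tsum_amplitude :
    AEMeasurable (fun E => ∑' n, ENNReal.ofReal (‖ρW.amplitude E n‖ ^ 2)) volume :=
  AEMeasurable.tsum fun n =>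
    (ρW.integrable_norm_amplitude_sq n).1.aemeasurable.ennreal_ofReal

lemma ae_memℓp_amplitude : ∀ᵐ E, Memℓp (ρW.amplitude E) 2 := by
  filter_upwards [ae_lt_top' ρW.aemeasurable_tsum_amplitude ρW.lintegral_tsum_amplitude] with E hE
  refine (memℓp_gen_iff (by norm_num)).2 ?_
  have := ENNReal.summable_toReal hE.ne
  simpa [ENNReal.toReal_ofReal] using this

open Classical in
/-- The purified wave function, with values in `ℓ²(ℕ)`. -/
def purified (E : ℝ) : AuxSpace :=
  if h : Memℓp (ρW.amplitude E) 2 then ⟨ρW.amplitude E, h⟩ else 0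

variable {ρW}

lemma purified_apply {E : ℝ} (h : Memℓp (ρW.amplitude E) 2) (n : ℕ) :
    ρW.purified E n = ρW.amplitude E n := by
  rw [purified, dif_pos h]

/-- The two factors √qₙ recombine to qₙ; the arguments are reversed because the inner product is
conjugate-linear in the first slot. -/
lemma kernel_eq_inner {x y : ℝ} (hx : Memℓp (ρW.amplitude x) 2) (hy : Memℓp (ρW.amplitude y) 2) :
    ρW.kernel x y = ⟪ρW.purified y, ρW.purified x⟫_ℂ := by
  rw [lp.inner_eq_tsum, kernel]
  congr 1 with n
  rw [purified_apply hx, purified_apply hy, amplitude, amplitude, RCLike.inner_apply]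
  have h : ((Real.sqrt (ρW.prob n) : ℝ) : ℂ) * (Real.sqrt (ρW.prob n) : ℝ) = ρW.prob n := by
    rw [← Complex.ofReal_mul, Real.mul_self_sqrt (ρW.prob_nonneg n)]
  rw [map_mul, Complex.conj_ofReal, ← h, ← starRingEnd_apply]
  ring

lemma energyDensity_eq_norm_sq {x : ℝ} (hx : Memℓp (ρW.amplitude x) 2) :
    ρW.energyDensity x = ‖ρW.purified x‖ ^ 2 := by
  rw [energyDensity, kernel_eq_inner hx hx, inner_self_eq_norm_sq_to_K]
  norm_cast

lemma norm_purified_sq {x : ℝ} (hx : Memℓp (ρW.amplitude x) 2) :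
    ‖ρW.purified x‖ ^ 2 = (∑' n, ENNReal.ofReal (‖ρW.amplitude x n‖ ^ 2)).toReal := by
  have h := lp.norm_rpow_eq_tsum (p := 2) (by norm_num) (ρW.purified x)
  simp only [ENNReal.toReal_ofNat, Real.rpow_ofNat, purified_apply hx] at h
  rw [h, ENNReal.tsum_toReal_eq fun n => ENNReal.ofReal_ne_top]
  congr 1 with n
  rw [ENNReal.toReal_ofReal (sq_nonneg _)]

variable (ρW)

/-- The finite coordinate sums are measurable and converge in ℓ² at almost every energy. -/
lemma aestronglyMeasurable_purified : AEStronglyMeasurable ρW.purified volume := by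
  refine aestronglyMeasurable_of_tendsto_ae atTop
    (f := fun (N : ℕ) E => ∑ n ∈ Finset.range N, lp.single 2 n (ρW.amplitude E n)) ?_ ?_
  · intro N
    refine Finset.aestronglyMeasurable_fun_sum _ fun n _ => ?_
    exact (lp.isometry_single (E := fun _ : ℕ => ℂ) (p := 2) n).continuous.comp_aestronglyMeasurable
      (ρW.aestronglyMeasurable_amplitude n)
  · filter_upwards [ρW.ae_memℓp_amplitude] with E hE
    have h := lp.hasSum_single (p := 2) (by norm_num) (ρW.purified E)
    simp only [purified_apply hE] at h
    exact h.tendsto_sum_nat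

lemma memLp_purified : MemLp ρW.purified 2 volume := by
  rw [memLp_two_iff_integrable_sq_norm ρW.aestronglyMeasurable_purified]
  refine (integrable_toReal_of_lintegral_ne_top ρW.aemeasurable_tsum_amplitude
    ρW.lintegral_tsum_amplitude).congr ?_
  filter_upwards [ρW.ae_memℓp_amplitude] with E hE
  rw [norm_purified_sq hE]

variable {ρW}

lemma memLp_energy_smul_purified (hmoment : FiniteSecondMoment ρW.energyDensity) :
    MemLp (fun E : ℝ => (E : ℂ) • ρW.purified E) 2 volume := by
  have hm : AEStronglyMeasurable (fun E : ℝ => (E : ℂ) • ρW.purified E) volume :=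
    Complex.continuous_ofReal.aestronglyMeasurable.smul ρW.aestronglyMeasurable_purified
  rw [memLp_two_iff_integrable_sq_norm hm]
  refine Integrable.congr hmoment ?_
  filter_upwards [ρW.ae_memℓp_amplitude] with E hE
  rw [energyDensity_eq_norm_sq hE, norm_smul, mul_pow, Complex.norm_real, Real.norm_eq_abs, sq_abs]

/-- A state of the weight with finite energy variance is the reduced state of a vector `a` of
`L²(ℝ; ℓ²)` in the domain of the Hamiltonian. -/
theorem exists_purification (hmoment : FiniteSecondMoment ρW.energyDensity) :
    ∃ (a b : Lp AuxSpace 2 (volume : Measure ℝ)) (G : ℝ → Prop), (∀ᵐ x, G x) ∧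
      (∀ x, G x → b x = (x : ℂ) • a x) ∧
      ∀ x y, G x → G y → ρW.kernel x y = ⟪a y, a x⟫_ℂ := by
  have hb := memLp_energy_smul_purified hmoment
  have ha := ρW.memLp_purified
  -- The kernel is defined pointwise, so a conull set is kept on which the L² representatives take
  -- the intended values.
  refine ⟨ha.toLp _, hb.toLp _, fun x => Memℓp (ρW.amplitude x) 2 ∧
    (ha.toLp _ : ℝ → AuxSpace) x = ρW.purified x ∧
      (hb.toLp _ : ℝ → AuxSpace) x = (x : ℂ) • ρW.purified x, ?_, ?_, ?_⟩
  · filter_upwards [ρW.ae_memℓp_amplitude, ha.coeFn_toLp, hb.coeFn_toLp]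
      with x h1 h2 h3 using ⟨h1, h2, h3⟩
  · rintro x ⟨-, h2, h3⟩
    rw [h2, h3]
  · rintro x y ⟨hx, hx', -⟩ ⟨hy, hy', -⟩
    rw [hx', hy', kernel_eq_inner hx hy]

end WeightState

end Purification

/-! ### Wigner integrals as integrals of the shifted kernel -/

section WignerIntegrals

lemma quasiMeasurePreserving_mul_left {c : ℝ} (hc : c ≠ 0) :
    Measure.QuasiMeasurePreserving (fun x : ℝ => c * x) volume volume :=
  ⟨by fun_prop, by
    rw [Real.map_volume_mul_left hc]
    exact Measure.smul_absolutelyContinuous⟩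

lemma ae_sub_half {G : ℝ → Prop} (hG : ∀ᵐ x, G x) (E : ℝ) : ∀ᵐ ν : ℝ, G (E - ν / 2) := by
  have h := ((measurePreserving_add_left (volume : Measure ℝ) E).quasiMeasurePreserving.comp
    (quasiMeasurePreserving_mul_left (c := -(1 / 2)) (by norm_num))).ae hG
  filter_upwards [h] with ν hν
  simpa [div_eq_inv_mul, sub_eq_add_neg] using hν

lemma ae_add_half {G : ℝ → Prop} (hG : ∀ᵐ x, G x) (E : ℝ) : ∀ᵐ ν : ℝ, G (E + ν / 2) := by
  have h := ((measurePreserving_add_left (volume : Measure ℝ) E).quasiMeasurePreserving.comp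
    (quasiMeasurePreserving_mul_left (c := 1 / 2) (by norm_num))).ae hG
  filter_upwards [h] with ν hν
  simpa [div_eq_inv_mul] using hν

lemma ae_add_const {G : ℝ → Prop} (hG : ∀ᵐ x, G x) (h : ℝ) : ∀ᵐ x : ℝ, G (x + h) :=
  (measurePreserving_add_right (volume : Measure ℝ) h).quasiMeasurePreserving.ae hG

namespace WeightState

variable {ρW : WeightState}

/-- The substitution t = 2πs passes to the normalisation of `fourierChar` and absorbs the prefactor
1/(2π). -/
lemma wigner_two_pi_mul (E s : ℝ) :
    (2 * Real.pi : ℂ) * ρW.wigner E (2 * Real.pi * s) =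
      ∫ ν, fourierChar (ν * s) • ρW.kernel (E - ν / 2) (E + ν / 2) := by
  have hpi : (2 * Real.pi : ℂ) ≠ 0 := by simp [Real.pi_ne_zero]
  rw [wigner, ← mul_assoc, mul_one_div_cancel hpi, one_mul]
  congr 1 with ν
  rw [Circle.smul_def, Real.fourierChar_apply, smul_eq_mul]
  congr 2
  push_cast
  ring

variable {F : Type*} [NormedAddCommGroup F] [InnerProductSpace ℂ F] [CompleteSpace F]
  {a : Lp F 2 (volume : Measure ℝ)} {b : Lp F 2 (volume : Measure ℝ)} {G : ℝ → Prop}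

lemma wigner_eq_crossWigner (hG : ∀ᵐ x, G x)
    (hk : ∀ x y, G x → G y → ρW.kernel x y = ⟪a y, a x⟫_ℂ) (E s : ℝ) :
    (2 * Real.pi : ℂ) * ρW.wigner E (2 * Real.pi * s) = crossWigner a a E s := by
  rw [wigner_two_pi_mul, crossWigner]
  refine integral_congr_ae ?_
  filter_upwards [ae_sub_half hG E, ae_add_half hG E] with ν h1 h2
  rw [hk _ _ h1 h2]

lemma memLp_pair (a b : Lp F 2 (volume : Measure ℝ)) (c : ℂ) :
    MemLp (fun x => (WithLp.toLp 2 ![c • a x, c • b x] : PiLp 2 fun _ : Fin 2 => F)) 2 volume := by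
  refine MemLp.of_eval_piLp fun i => ?_
  fin_cases i
  · exact (Lp.memLp a).const_smul c
  · exact (Lp.memLp b).const_smul c

/-- The function `E W(E, t)` is the cross-Wigner function of a pair of square-integrable functions,
whose correlation is the first moment of the shifted kernel. -/
lemma exists_crossWigner_energy (hG : ∀ᵐ x, G x) (hb : ∀ x, G x → b x = (x : ℂ) • a x)
    (hk : ∀ x y, G x → G y → ρW.kernel x y = ⟪a y, a x⟫_ℂ) :
    ∃ A B : Lp (PiLp 2 fun _ : Fin 2 => F) 2 (volume : Measure ℝ),
      (∀ E s : ℝ, (E : ℂ) * ((2 * Real.pi : ℂ) * ρW.wigner E (2 * Real.pi * s)) =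
        crossWigner A B E s) ∧
      ∀ h : ℝ, ∫ x, ⟪B (x - h / 2), A (x + h / 2)⟫_ℂ =
        ∫ x : ℝ, (x : ℂ) * ρW.kernel (x + h / 2) (x - h / 2) := by
  -- With A = (b/2, a/2) and B = (a, b), the inner product of B(y) and A(x) is (x+y)/2 times the
  -- kernel; at x, y = E ∓ ν/2 this factor is exactly E.
  have hA := memLp_pair b a (1 / 2)
  have hB := memLp_pair a b 1
  have hgood : ∀ᵐ x, G x ∧ hA.toLp _ x = WithLp.toLp 2 ![(1 / 2 : ℂ) • b x, (1 / 2 : ℂ) • a x] ∧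
      hB.toLp _ x = WithLp.toLp 2 ![(1 : ℂ) • a x, (1 : ℂ) • b x] := by
    filter_upwards [hG, hA.coeFn_toLp, hB.coeFn_toLp] with x h1 h2 h3 using ⟨h1, h2, h3⟩
  have key : ∀ x y, (G x ∧ hA.toLp _ x =
      WithLp.toLp 2 ![(1 / 2 : ℂ) • b x, (1 / 2 : ℂ) • a x] ∧
      hB.toLp _ x = WithLp.toLp 2 ![(1 : ℂ) • a x, (1 : ℂ) • b x]) →
      (G y ∧ hA.toLp _ y = WithLp.toLp 2 ![(1 / 2 : ℂ) • b y, (1 / 2 : ℂ) • a y] ∧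
      hB.toLp _ y = WithLp.toLp 2 ![(1 : ℂ) • a y, (1 : ℂ) • b y]) →
      ⟪hB.toLp _ y, hA.toLp _ x⟫_ℂ = (((x + y) / 2 : ℝ) : ℂ) * ρW.kernel x y := by
    rintro x y ⟨hx, hx1, -⟩ ⟨hy, -, hy2⟩
    rw [hx1, hy2, PiLp.inner_apply, Fin.sum_univ_two]
    simp only [Matrix.cons_val_zero, Matrix.cons_val_one, one_smul, inner_smul_right]
    rw [hb x hx, hb y hy, inner_smul_left, inner_smul_right, hk x y hx hy, Complex.conj_ofReal]
    push_cast
    ring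
  refine ⟨hA.toLp _, hB.toLp _, fun E s => ?_, fun h => ?_⟩
  · rw [wigner_two_pi_mul, crossWigner, ← integral_const_mul]
    refine integral_congr_ae ?_
    filter_upwards [ae_sub_half hgood E, ae_add_half hgood E] with ν h1 h2
    rw [key _ _ h1 h2, Circle.smul_def, Circle.smul_def, smul_eq_mul, smul_eq_mul,
      show (E - ν / 2 + (E + ν / 2)) / 2 = E by ring]
    ring
  · refine integral_congr_ae ?_
    filter_upwards [ae_add_const hgood (h / 2), ae_add_const hgood (-(h / 2))] with x h1 h2
    rw [← sub_eq_add_neg] at h2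
    rw [key _ _ h1 h2, show (x + h / 2 + (x - h / 2)) / 2 = x by ring]

/-- The function is bounded, which suffices for |E| ≤ 1; for |E| > 1 it is dominated by its product
with E. Thus γ needs no integrability assumption of its own. -/
lemma integrable_crossWigner_of_energy (hG : ∀ᵐ x, G x)
    (hk : ∀ x y, G x → G y → ρW.kernel x y = ⟪a y, a x⟫_ℂ) {s : ℝ}
    (h : Integrable fun E : ℝ => (E : ℂ) * ρW.wigner E (2 * Real.pi * s)) :
    Integrable fun E => crossWigner a a E s := by
  let C : ℝ := 2 * ((∫ x, ‖a x‖ ^ 2) + ∫ x, ‖a x‖ ^ 2)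
  have hC : ∀ E, ‖crossWigner a a E s‖ ≤ C := by
    intro E
    refine (norm_integral_le_integral_norm _).trans ?_
    simp only [Circle.norm_smul]
    exact integral_norm_inner_mid_le a a E
  have hmeas : AEStronglyMeasurable (fun E => crossWigner a a E s) volume := by
    refine StronglyMeasurable.aestronglyMeasurable ?_
    have hf : Continuous fun z : ℝ × ℝ => (fourierChar (z.2 * s) : ℂ) := by fun_prop
    exact (hf.stronglyMeasurable.smul (stronglyMeasurable_inner_prod a a)).integral_prod_right'
  have hind : Integrable ((Set.Icc (-1 : ℝ) 1).indicator fun _ => C) :=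
    (integrable_indicator_iff measurableSet_Icc).2 (by
      rw [IntegrableOn]; exact integrable_const _)
  refine (hind.add ((h.norm).const_mul (2 * Real.pi))).mono' hmeas
    (Eventually.of_forall fun E => ?_)
  have hpi := Real.pi_pos
  simp only [Pi.add_apply]
  by_cases hE : E ∈ Set.Icc (-1 : ℝ) 1
  · rw [Set.indicator_of_mem hE]
    have : 0 ≤ 2 * Real.pi * ‖(E : ℂ) * ρW.wigner E (2 * Real.pi * s)‖ := by positivity
    linarith [hC E]
  · rw [Set.indicator_of_notMem hE, zero_add, ← wigner_eq_crossWigner hG hk, norm_mul,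
      norm_mul (E : ℂ)]
    have h1 : ‖(2 * Real.pi : ℂ)‖ = 2 * Real.pi := by
      simp [abs_of_pos hpi]
    have h2 : 1 ≤ ‖(E : ℂ)‖ := by
      rw [Complex.norm_real, Real.norm_eq_abs]
      by_contra! hlt
      exact hE ⟨(abs_lt.1 hlt).1.le, (abs_lt.1 hlt).2.le⟩
    rw [h1]
    exact mul_le_mul_of_nonneg_left (le_mul_of_one_le_left (norm_nonneg _) h2) (by positivity)

lemma ae_two_pi_mul {P : ℝ → Prop} (h : ∀ᵐ t, P t) : ∀ᵐ s, P (2 * Real.pi * s) :=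
  (quasiMeasurePreserving_mul_left (by simp [Real.pi_ne_zero])).ae h

lemma integral_exp_eq_integral_fourierChar (ω : ℝ) (g : ℝ → ℂ) :
    ∫ t : ℝ, Complex.exp (Complex.I * ω * t) * g t =
      ∫ s : ℝ, (fourierChar (s * ω) : ℂ) * ((2 * Real.pi : ℂ) * g (2 * Real.pi * s)) := by
  have hpi := Real.pi_pos
  have h := Measure.integral_comp_mul_left
    (fun t : ℝ => Complex.exp (Complex.I * ω * t) * g t) (2 * Real.pi)
  rw [abs_of_pos (by positivity)] at h
  have h2 : ∫ t : ℝ, Complex.exp (Complex.I * ω * t) * g t = (2 * Real.pi : ℂ) *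
      ∫ s : ℝ, Complex.exp (Complex.I * ω * ((2 * Real.pi * s : ℝ) : ℂ)) *
        g (2 * Real.pi * s) := by
    rw [h, Complex.real_smul]
    push_cast
    rw [← mul_assoc, mul_inv_cancel₀ (by simp [Real.pi_ne_zero]), one_mul]
  rw [h2, ← integral_const_mul]
  congr 1 with s
  rw [Real.fourierChar_apply]
  have : Complex.exp (Complex.I * ω * ((2 * Real.pi * s : ℝ) : ℂ)) =
      Complex.exp (((2 * Real.pi * (s * ω) : ℝ) : ℂ) * Complex.I) := by
    congr 1
    push_cast
    ring
  rw [this]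
  ring

/-- The Wigner integral of `e^{iωt}` is the correlation function of the kernel. -/
theorem gammaInt_eq (hmoment : FiniteSecondMoment ρW.energyDensity)
    (hwigner : ρW.WignerMomentExists) (ω : ℝ) :
    gammaInt ω ρW = ∫ x : ℝ, ρW.kernel (x + ω / 2) (x - ω / 2) := by
  obtain ⟨a, b, G, hG, hb, hk⟩ := exists_purification hmoment
  have hw : ∀ᵐ s, Integrable fun E => crossWigner a a E s := by
    filter_upwards [ae_two_pi_mul hwigner.1] with s hs
    exact integrable_crossWigner_of_energy hG hk hs
  have h := integral_fourierChar_integral_crossWigner a a hw ω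
  simp only [← wigner_eq_crossWigner hG hk, integral_const_mul] at h
  rw [gammaInt]
  simp only [integral_mul_const]
  simp_rw [mul_comm _ (Complex.exp _)]
  rw [integral_exp_eq_integral_fourierChar ω, h]
  refine integral_congr_ae ?_
  filter_upwards [ae_add_const hG (ω / 2), ae_add_const hG (-(ω / 2))] with x h1 h2
  rw [← sub_eq_add_neg] at h2
  rw [hk _ _ h1 h2]

/-- The Wigner integral of `E e^{iωt}` is the first moment of the shifted kernel. -/
theorem integral_exp_mul_energy_wigner (hmoment : FiniteSecondMoment ρW.energyDensity)
    (hwigner : ρW.WignerMomentExists) (ω : ℝ) :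
    ∫ t : ℝ, Complex.exp (Complex.I * ω * t) * ∫ E : ℝ, (E : ℂ) * ρW.wigner E t =
      ∫ x : ℝ, (x : ℂ) * ρW.kernel (x + ω / 2) (x - ω / 2) := by
  obtain ⟨a, b, G, hG, hb, hk⟩ := exists_purification hmoment
  obtain ⟨A, B, hAB, hcorr⟩ := exists_crossWigner_energy hG hb hk
  have hAB' : ∀ E s : ℝ, crossWigner A B E s =
      (2 * Real.pi : ℂ) * ((E : ℂ) * ρW.wigner E (2 * Real.pi * s)) := by
    intro E s
    rw [← hAB]
    ring
  have hw : ∀ᵐ s, Integrable fun E => crossWigner A B E s := by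
    filter_upwards [ae_two_pi_mul hwigner.1] with s hs
    simp only [hAB']
    exact hs.const_mul _
  have h := integral_fourierChar_integral_crossWigner A B hw ω
  simp only [hAB', integral_const_mul] at h
  rw [integral_exp_eq_integral_fourierChar ω, h, hcorr]

/-- Multiplying an integrable marginal by a phase keeps it integrable, so the integral splits; the
second term is the first with ω replaced by −ω. -/
lemma integral_energy_wigner_phases (hmoment : FiniteSecondMoment ρW.energyDensity)
    (hwigner : ρW.WignerMomentExists) (ω : ℝ) (c d : ℂ) :
    ∫ t : ℝ, ∫ E : ℝ, (E : ℂ) * ρW.wigner E t * (Complex.exp (Complex.I * ω * t) * c +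
        Complex.exp (-(Complex.I * ω * t)) * d) =
      c * (∫ x : ℝ, (x : ℂ) * ρW.kernel (x + ω / 2) (x - ω / 2)) +
        d * ∫ x : ℝ, (x : ℂ) * ρW.kernel (x - ω / 2) (x + ω / 2) := by
  have hphase : ∀ ω' : ℝ, Integrable fun t : ℝ =>
      Complex.exp (Complex.I * ω' * t) * ∫ E : ℝ, (E : ℂ) * ρW.wigner E t := by
    intro ω'
    refine hwigner.2.bdd_mul (c := 1) (f := fun t : ℝ => Complex.exp (Complex.I * ω' * t)) ?_
      (Eventually.of_forall fun t => ?_)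
    · exact (by fun_prop : Continuous fun t : ℝ =>
        Complex.exp (Complex.I * ω' * t)).aestronglyMeasurable
    · rw [mul_assoc, ← Complex.ofReal_mul, Complex.norm_exp_I_mul_ofReal]
  have hneg := integral_exp_mul_energy_wigner hmoment hwigner (-ω)
  simp only [neg_div, sub_neg_eq_add, ← sub_eq_add_neg] at hneg
  rw [← integral_exp_mul_energy_wigner hmoment hwigner ω, ← hneg, ← integral_const_mul,
    ← integral_const_mul, ← integral_add ((hphase ω).const_mul c) ((hphase (-ω)).const_mul d)]
  congr 1 with t
  rw [integral_mul_const]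
  push_cast
  simp only [mul_neg, neg_mul]
  ring

lemma kernel_conj (x y : ℝ) : star (ρW.kernel x y) = ρW.kernel y x := by
  rw [kernel, kernel, tsum_star]
  congr 1 with n
  simp only [star_mul', star_star]
  rw [Complex.star_def, Complex.conj_ofReal]
  ring

lemma integral_energy_kernel_conj (y : ℝ) :
    ∫ x : ℝ, (x : ℂ) * ρW.kernel (x - y) (x + y) =
      star (∫ x : ℝ, (x : ℂ) * ρW.kernel (x + y) (x - y)) := by
  rw [Complex.star_def, ← integral_conj]
  congr 1 with x
  rw [map_mul, Complex.conj_ofReal, ← Complex.star_def, kernel_conj]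

/-- The moments of the shifted kernel exist. -/
theorem integrable_pow_mul_kernel (hmoment : FiniteSecondMoment ρW.energyDensity) (m : Fin 3)
    (y y' : ℝ) : Integrable fun E : ℝ => (E : ℂ) ^ (m : ℕ) * ρW.kernel (E + y) (E + y') := by
  obtain ⟨a, b, G, hG, hb, hk⟩ := exists_purification hmoment
  have i00 := integrable_inner_shift a a y' y
  have i01 := integrable_inner_shift b a y' y
  have i10 := integrable_inner_shift a b y' y
  have i11 := integrable_inner_shift b b y' y
  fin_cases m
  · refine i00.congr ?_
    filter_upwards [ae_add_const hG y, ae_add_const hG y'] with x h1 h2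
    simp [hk _ _ h1 h2]
  · refine (i01.sub (i00.const_mul (y : ℂ))).congr ?_
    filter_upwards [ae_add_const hG y, ae_add_const hG y'] with x h1 h2
    simp only [Pi.sub_apply, hk _ _ h1 h2, hb _ h1, inner_smul_right]
    push_cast
    ring
  -- Expansion of E² as ((E+y)−y)((E+y')−y'); each factor E+y or E+y' turns a copy of a into b.
  · refine ((i11.sub (i01.const_mul (y' : ℂ))).sub ((i10.const_mul (y : ℂ)).sub
      (i00.const_mul (y * y' : ℂ)))).congr ?_
    filter_upwards [ae_add_const hG y, ae_add_const hG y'] with x h1 h2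
    simp only [Pi.sub_apply, hk _ _ h1 h2, hb _ h1, hb _ h2, inner_smul_right, inner_smul_left,
      Complex.conj_ofReal]
    push_cast
    ring

end WeightState

end WignerIntegrals

/-! ### Energy moments after a protocol -/

section FinalState

variable {ω : ℝ} {ρS : Matrix (Fin 2) (Fin 2) ℂ} {ρW : WeightState}

/-- The `m`-th energy moments `∫ Eᵐ ⟨E, j| S (ρ_S ⊗ ρ_W) S† |E, l⟩ dE` of the state after the
controlled shift. -/
def shiftMoment (ω : ℝ) (ρS : Matrix (Fin 2) (Fin 2) ℂ) (ρW : WeightState) (m : ℕ) :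
    Matrix (Fin 2) (Fin 2) ℂ :=
  Matrix.of fun j l => ρS j l *
    ∫ E : ℝ, (E : ℂ) ^ m * ρW.kernel (E - level ω j) (E - level ω l)

/-- The diagonal entry `(V M V†)ᵢᵢ`. -/
def rowForm (V M : Matrix (Fin 2) (Fin 2) ℂ) (i : Fin 2) : ℂ :=
  ∑ j, ∑ l, V i j * star (V i l) * M j l

/-- The state after the controlled shift, as a matrix of functions of the energy. -/
def shiftedKernel (ω : ℝ) (ρS : Matrix (Fin 2) (Fin 2) ℂ) (ρW : WeightState) (E : ℝ) :
    Matrix (Fin 2) (Fin 2) ℂ :=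
  Matrix.of fun j l => ρS j l * ρW.kernel (E - level ω j) (E - level ω l)

lemma weightEnergyDensity_finalState (V : Matrix (Fin 2) (Fin 2) ℂ) (E : ℝ) :
    weightEnergyDensity (finalState ω ρS ρW V) E =
      (∑ i, rowForm V (shiftedKernel ω ρS ρW (E + level ω i)) i).re := by
  rw [weightEnergyDensity, Complex.re_sum]
  congr 1 with i
  congr 1
  simp only [finalState, conjugate, adj, mulLeft, protocolU, opSDagger, opS, onQubit,
    controlledShift, productState, rowForm, shiftedKernel, Matrix.of_apply, Fin.sum_univ_two,
    star_add, star_mul', star_star, neg_mul, one_mul, sub_neg_eq_add]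
  ring

/-- The initial distribution is that of the trivial protocol, so both changes are differences of
values of one formula. -/
lemma weightEnergyDensity_productState (E : ℝ) :
    weightEnergyDensity (productState ρS ρW) E =
      weightEnergyDensity (finalState ω ρS ρW 1) E := by
  rw [weightEnergyDensity_finalState, weightEnergyDensity, Complex.re_sum, Fin.sum_univ_two,
    Fin.sum_univ_two]
  simp [rowForm, shiftedKernel, productState, Fin.sum_univ_two]

lemma controlMarginal_eq : controlMarginal ω ρS ρW = shiftMoment ω ρS ρW 0 := by
  ext i j
  simp only [controlMarginal, traceWeight, conjugate, adj, mulLeft, opS, controlledShift,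
    productState, shiftMoment, Matrix.of_apply, star_star, one_mul, pow_zero]
  rw [integral_const_mul]

lemma integrable_pow_mul_rowForm (hmoment : FiniteSecondMoment ρW.energyDensity)
    (V : Matrix (Fin 2) (Fin 2) ℂ) (i : Fin 2) (m : Fin 3) :
    Integrable fun E : ℝ => (E : ℂ) ^ (m : ℕ) * rowForm V (shiftedKernel ω ρS ρW E) i := by
  have h : ∀ j l, Integrable fun E : ℝ => V i j * star (V i l) * ρS j l *
      ((E : ℂ) ^ (m : ℕ) * ρW.kernel (E - level ω j) (E - level ω l)) := fun j l =>
    (WeightState.integrable_pow_mul_kernel hmoment m (-level ω j) (-level ω l)).const_mul _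
  refine (integrable_finsetSum Finset.univ fun j _ =>
    integrable_finsetSum Finset.univ fun l _ => h j l).congr (Eventually.of_forall fun E => ?_)
  simp only [rowForm, shiftedKernel, Matrix.of_apply, Fin.sum_univ_two]
  ring

lemma integral_pow_mul_rowForm (hmoment : FiniteSecondMoment ρW.energyDensity)
    (V : Matrix (Fin 2) (Fin 2) ℂ) (i : Fin 2) (m : Fin 3) :
    ∫ E : ℝ, (E : ℂ) ^ (m : ℕ) * rowForm V (shiftedKernel ω ρS ρW E) i =
      rowForm V (shiftMoment ω ρS ρW m) i := by
  have h : ∀ j l, Integrable fun E : ℝ => V i j * star (V i l) * ρS j l *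
      ((E : ℂ) ^ (m : ℕ) * ρW.kernel (E - level ω j) (E - level ω l)) := fun j l =>
    (WeightState.integrable_pow_mul_kernel hmoment m (-level ω j) (-level ω l)).const_mul _
  have e : ∀ E : ℝ, (E : ℂ) ^ (m : ℕ) * rowForm V (shiftedKernel ω ρS ρW E) i =
      ∑ j, ∑ l, V i j * star (V i l) * ρS j l *
      ((E : ℂ) ^ (m : ℕ) * ρW.kernel (E - level ω j) (E - level ω l)) := by
    intro E
    simp only [rowForm, shiftedKernel, Matrix.of_apply, Fin.sum_univ_two]
    ring
  simp only [e]
  rw [integral_finsetSum _ fun j _ => integrable_finsetSum Finset.univ fun l _ => h j l, rowForm]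
  congr 1 with j
  rw [integral_finsetSum _ fun l _ => h j l]
  congr 1 with l
  rw [integral_const_mul, shiftMoment, Matrix.of_apply]
  ring

/-- Translating the variable by c replaces E by E − c, and the powers are expanded. -/
lemma hasMoments_rowForm (hmoment : FiniteSecondMoment ρW.energyDensity)
    (V : Matrix (Fin 2) (Fin 2) ℂ) (i : Fin 2) (c : ℝ) :
    (Integrable fun E : ℝ => (E : ℂ) * rowForm V (shiftedKernel ω ρS ρW (E + c)) i) ∧
    (∫ E : ℝ, (E : ℂ) * rowForm V (shiftedKernel ω ρS ρW (E + c)) i =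
      rowForm V (shiftMoment ω ρS ρW 1) i - c * rowForm V (shiftMoment ω ρS ρW 0) i) ∧
    (Integrable fun E : ℝ => (E : ℂ) ^ 2 * rowForm V (shiftedKernel ω ρS ρW (E + c)) i) ∧
    ∫ E : ℝ, (E : ℂ) ^ 2 * rowForm V (shiftedKernel ω ρS ρW (E + c)) i =
      rowForm V (shiftMoment ω ρS ρW 2) i - 2 * c * rowForm V (shiftMoment ω ρS ρW 1) i +
        c ^ 2 * rowForm V (shiftMoment ω ρS ρW 0) i := by
  have i0 := integrable_pow_mul_rowForm (ω := ω) (ρS := ρS) hmoment V i 0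
  have i1 := integrable_pow_mul_rowForm (ω := ω) (ρS := ρS) hmoment V i 1
  have i2 := integrable_pow_mul_rowForm (ω := ω) (ρS := ρS) hmoment V i 2
  have e0 := integral_pow_mul_rowForm (ω := ω) (ρS := ρS) hmoment V i 0
  have e1 := integral_pow_mul_rowForm (ω := ω) (ρS := ρS) hmoment V i 1
  have e2 := integral_pow_mul_rowForm (ω := ω) (ρS := ρS) hmoment V i 2
  simp only [Fin.val_zero, Fin.val_one, Fin.val_two] at i0 i1 i2 e0 e1 e2
  have f1 : ∀ E : ℝ, (E : ℂ) * rowForm V (shiftedKernel ω ρS ρW (E + c)) i =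
      (fun E : ℝ => (E : ℂ) ^ 1 * rowForm V (shiftedKernel ω ρS ρW E) i -
        c * ((E : ℂ) ^ 0 * rowForm V (shiftedKernel ω ρS ρW E) i)) (E + c) := by
    intro E
    push_cast
    ring
  have f2 : ∀ E : ℝ, (E : ℂ) ^ 2 * rowForm V (shiftedKernel ω ρS ρW (E + c)) i =
      (fun E : ℝ => (E : ℂ) ^ 2 * rowForm V (shiftedKernel ω ρS ρW E) i -
        2 * c * ((E : ℂ) ^ 1 * rowForm V (shiftedKernel ω ρS ρW E) i) +
        c ^ 2 * ((E : ℂ) ^ 0 * rowForm V (shiftedKernel ω ρS ρW E) i)) (E + c) := by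
    intro E
    push_cast
    ring
  have g1 := i1.sub (i0.const_mul (c : ℂ))
  have g2 := (i2.sub (i1.const_mul (2 * c : ℂ))).add (i0.const_mul (c ^ 2 : ℂ))
  refine ⟨?_, ?_, ?_, ?_⟩
  · simp only [f1]
    exact g1.comp_add_right c
  · simp only [f1]
    rw [integral_add_right_eq_self (fun E : ℝ =>
      (E : ℂ) ^ 1 * rowForm V (shiftedKernel ω ρS ρW E) i -
        c * ((E : ℂ) ^ 0 * rowForm V (shiftedKernel ω ρS ρW E) i)),
      integral_sub i1 (i0.const_mul _), integral_const_mul, e0, e1]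
  · simp only [f2]
    exact g2.comp_add_right c
  · simp only [f2]
    have g3 : Integrable fun E : ℝ => (E : ℂ) ^ 2 * rowForm V (shiftedKernel ω ρS ρW E) i -
        2 * c * ((E : ℂ) ^ 1 * rowForm V (shiftedKernel ω ρS ρW E) i) :=
      i2.sub (i1.const_mul (2 * c : ℂ))
    rw [integral_add_right_eq_self (fun E : ℝ =>
      (E : ℂ) ^ 2 * rowForm V (shiftedKernel ω ρS ρW E) i -
        2 * c * ((E : ℂ) ^ 1 * rowForm V (shiftedKernel ω ρS ρW E) i) +
        c ^ 2 * ((E : ℂ) ^ 0 * rowForm V (shiftedKernel ω ρS ρW E) i)),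
      integral_add g3 (i0.const_mul (c ^ 2 : ℂ)),
      integral_sub i2 (i1.const_mul (2 * c : ℂ)), integral_const_mul, integral_const_mul, e0, e1, e2]

/-- Invariance of the trace under V M V†; it eliminates row 0 from all later formulas. -/
lemma sum_rowForm {V : Matrix (Fin 2) (Fin 2) ℂ} (hV : V ∈ Matrix.unitaryGroup (Fin 2) ℂ)
    (M : Matrix (Fin 2) (Fin 2) ℂ) : rowForm V M 0 + rowForm V M 1 = M.trace := by
  have h := Matrix.mem_unitaryGroup_iff'.1 hV
  have h00 := congrFun (congrFun h 0) 0
  have h01 := congrFun (congrFun h 0) 1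
  have h10 := congrFun (congrFun h 1) 0
  have h11 := congrFun (congrFun h 1) 1
  simp [Matrix.mul_apply, Fin.sum_univ_two, Matrix.star_apply] at h00 h01 h10 h11
  simp only [rowForm, Fin.sum_univ_two, Matrix.trace, Matrix.diag, ← starRingEnd_apply]
  linear_combination M 0 0 * h00 + M 1 0 * h01 + M 0 1 * h10 + M 1 1 * h11

/-- Only the output |1⟩ is shifted, since the other level is 0; the unshifted contributions of both
rows add up to traces independent of `V`. -/
lemma energy_moments_finalState (hmoment : FiniteSecondMoment ρW.energyDensity)
    {V : Matrix (Fin 2) (Fin 2) ℂ} (hV : V ∈ Matrix.unitaryGroup (Fin 2) ℂ) :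
    FiniteSecondMoment (weightEnergyDensity (finalState ω ρS ρW V)) ∧
    ∫ E, E * weightEnergyDensity (finalState ω ρS ρW V) E =
      (shiftMoment ω ρS ρW 1).trace.re - ω * (rowForm V (shiftMoment ω ρS ρW 0) 1).re ∧
    ∫ E, E ^ 2 * weightEnergyDensity (finalState ω ρS ρW V) E =
      (shiftMoment ω ρS ρW 2).trace.re - 2 * ω * (rowForm V (shiftMoment ω ρS ρW 1) 1).re +
        ω ^ 2 * (rowForm V (shiftMoment ω ρS ρW 0) 1).re := by
  have hm := fun i : Fin 2 =>
    hasMoments_rowForm (ω := ω) (ρS := ρS) hmoment V i (level ω i)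
  have hl0 : level ω 0 = 0 := rfl
  have hl1 : level ω 1 = ω := rfl
  have f1 : ∀ E : ℝ, E * weightEnergyDensity (finalState ω ρS ρW V) E =
      Complex.re ((E : ℂ) * rowForm V (shiftedKernel ω ρS ρW (E + level ω 0)) 0 +
        (E : ℂ) * rowForm V (shiftedKernel ω ρS ρW (E + level ω 1)) 1) := by
    intro E
    rw [weightEnergyDensity_finalState, ← mul_add, Complex.re_ofReal_mul, Fin.sum_univ_two]
  have f2 : ∀ E : ℝ, E ^ 2 * weightEnergyDensity (finalState ω ρS ρW V) E =
      Complex.re ((E : ℂ) ^ 2 * rowForm V (shiftedKernel ω ρS ρW (E + level ω 0)) 0 +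
        (E : ℂ) ^ 2 * rowForm V (shiftedKernel ω ρS ρW (E + level ω 1)) 1) := by
    intro E
    rw [weightEnergyDensity_finalState, ← mul_add, ← Complex.ofReal_pow, Complex.re_ofReal_mul,
      Fin.sum_univ_two]
  have g1 := (hm 0).1.add (hm 1).1
  have g2 := (hm 0).2.2.1.add (hm 1).2.2.1
  refine ⟨?_, ?_, ?_⟩
  · unfold FiniteSecondMoment
    simp only [f2]
    exact g2.re
  · simp only [f1]
    refine (integral_re g1).trans ?_
    simp only [Pi.add_apply]
    rw [integral_add (hm 0).1 (hm 1).1, (hm 0).2.1, (hm 1).2.1, ← sum_rowForm hV, hl0, hl1]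
    simp
    ring
  · simp only [f2]
    refine (integral_re g2).trans ?_
    simp only [Pi.add_apply]
    rw [integral_add (hm 0).2.2.1 (hm 1).2.2.1, (hm 0).2.2.2, (hm 1).2.2.2, ← sum_rowForm hV, hl0,
      hl1]
    simp [← Complex.ofReal_pow, mul_assoc]
    ring

end FinalState

/-! ### Reduction to the control-marginal state -/

section Reduction

variable {ω : ℝ} {ρS : Matrix (Fin 2) (Fin 2) ℂ} {ρW : WeightState}

/-- The first moment of the kernel shifted by `ω`, relative to its integral, in units of `ω`. -/
def relMoment (ω : ℝ) (ρW : WeightState) : ℂ :=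
  (∫ x : ℝ, (x : ℂ) * ρW.kernel (x + ω / 2) (x - ω / 2)) / (gammaInt ω ρW * ω)

/-- The two phases give complex conjugate integrals because the kernel is Hermitian; hence η is
real. -/
lemma etaInt_eq (hmoment : FiniteSecondMoment ρW.energyDensity)
    (hwigner : ρW.WignerMomentExists) :
    etaInt ω ρW = relMoment ω ρW + star (relMoment ω ρW) := by
  rw [etaInt, WeightState.integral_energy_wigner_phases hmoment hwigner,
    WeightState.integral_energy_kernel_conj, relMoment]
  simp only [Complex.star_def, map_div₀, map_mul, Complex.conj_ofReal]
  ring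

lemma xiInt_eq (hmoment : FiniteSecondMoment ρW.energyDensity)
    (hwigner : ρW.WignerMomentExists) (ε₀ ε₁ : ℝ) :
    xiInt ω ε₀ ε₁ ρW = ε₁ * relMoment ω ρW - ε₀ * star (relMoment ω ρW) := by
  have h := WeightState.integral_energy_wigner_phases hmoment hwigner ω
    (ε₁ / gammaInt ω ρW) (-(ε₀ / star (gammaInt ω ρW)))
  simp only [mul_neg, ← sub_eq_add_neg] at h
  rw [xiInt, h, WeightState.integral_energy_kernel_conj, relMoment]
  simp only [Complex.star_def, map_div₀, map_mul, Complex.conj_ofReal]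
  ring

/-- Recentring by c = ω/2 makes the off-diagonal kernels symmetric, as in the Wigner integrals; c =
ω undoes the shift in the (1,1) entry. -/
lemma shiftMoment_apply_add (m : ℕ) (j l : Fin 2) (c : ℝ) :
    shiftMoment ω ρS ρW m j l = ρS j l *
      ∫ E : ℝ, ((E + c : ℝ) : ℂ) ^ m * ρW.kernel (E + c - level ω j) (E + c - level ω l) := by
  rw [integral_add_right_eq_self (fun E : ℝ =>
    (E : ℂ) ^ m * ρW.kernel (E - level ω j) (E - level ω l)), shiftMoment, Matrix.of_apply]

lemma integral_energy_mul_kernel_diag (hmean : mean ρW.energyDensity = 0) :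
    ∫ E : ℝ, (E : ℂ) * ρW.kernel E E = 0 := by
  have h : ∀ E : ℝ, (E : ℂ) * ρW.kernel E E = ((E * ρW.energyDensity E : ℝ) : ℂ) := by
    intro E
    have := Complex.conj_eq_iff_re.1 (WeightState.kernel_conj (ρW := ρW) E E)
    rw [WeightState.energyDensity, Complex.ofReal_mul, this]
  simp only [h]
  rw [integral_complex_ofReal]
  exact congrArg _ hmean

lemma integral_add_mul {c : ℂ} {g : ℝ → ℂ} (h0 : Integrable g)
    (h1 : Integrable fun E : ℝ => (E : ℂ) * g E) :
    ∫ E : ℝ, ((E : ℂ) + c) * g E = (∫ E : ℝ, (E : ℂ) * g E) + c * ∫ E : ℝ, g E := by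
  simp only [add_mul]
  rw [integral_add h1 (h0.const_mul c), integral_const_mul]

/-- The first moments of the state after the controlled shift in terms of the control-marginal
state. -/
theorem shiftMoment_one_apply (hω : ω ≠ 0) (hmoment : FiniteSecondMoment ρW.energyDensity)
    (hmean : mean ρW.energyDensity = 0) (hwigner : ρW.WignerMomentExists)
    (hγ : gammaInt ω ρW ≠ 0) :
    shiftMoment ω ρS ρW 1 0 0 = 0 ∧
    shiftMoment ω ρS ρW 1 1 1 = ω * shiftMoment ω ρS ρW 0 1 1 ∧
    shiftMoment ω ρS ρW 1 0 1 = ω * (relMoment ω ρW + 1 / 2) * shiftMoment ω ρS ρW 0 0 1 ∧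
    shiftMoment ω ρS ρW 1 1 0 =
      ω * (star (relMoment ω ρW) + 1 / 2) * shiftMoment ω ρS ρW 0 1 0 := by
  have hl0 : level ω 0 = 0 := rfl
  have hl1 : level ω 1 = ω := rfl
  have hint := fun y y' : ℝ =>
    WeightState.integrable_pow_mul_kernel hmoment 0 y y'
  have hint1 := fun y y' : ℝ =>
    WeightState.integrable_pow_mul_kernel hmoment 1 y y'
  simp only [Fin.val_zero, Fin.val_one, pow_zero, pow_one, one_mul] at hint hint1
  have hωc : (ω : ℂ) ≠ 0 := Complex.ofReal_ne_zero.2 hω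
  have hg := WeightState.gammaInt_eq hmoment hwigner ω
  have hμ : (∫ x : ℝ, (x : ℂ) * ρW.kernel (x + ω / 2) (x - ω / 2)) =
      gammaInt ω ρW * ω * relMoment ω ρW := by
    rw [relMoment, mul_div_cancel₀]
    exact mul_ne_zero hγ hωc
  have hg' : (∫ x : ℝ, ρW.kernel (x - ω / 2) (x + ω / 2)) = star (gammaInt ω ρW) := by
    rw [hg, Complex.star_def, ← integral_conj]
    congr 1 with x
    rw [← Complex.star_def, WeightState.kernel_conj]
  have hμ' : (∫ x : ℝ, (x : ℂ) * ρW.kernel (x - ω / 2) (x + ω / 2)) =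
      star (gammaInt ω ρW) * ω * star (relMoment ω ρW) := by
    rw [WeightState.integral_energy_kernel_conj, hμ]
    simp only [Complex.star_def, map_mul, Complex.conj_ofReal]
  have s1 : ∀ E : ℝ, E + ω / 2 - ω = E - ω / 2 := fun E => by ring
  refine ⟨?_, ?_, ?_, ?_⟩
  · rw [shiftMoment_apply_add 1 0 0 0]
    simp only [hl0, add_zero, sub_zero, pow_one, integral_energy_mul_kernel_diag hmean, mul_zero]
  · rw [shiftMoment_apply_add 1 1 1 ω, shiftMoment_apply_add 0 1 1 ω]
    simp only [hl1, add_sub_cancel_right, pow_one, pow_zero, one_mul, Complex.ofReal_add]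
    have i0 := hint 0 0
    have i1 := hint1 0 0
    simp only [add_zero] at i0 i1
    rw [integral_add_mul i0 i1, integral_energy_mul_kernel_diag hmean]
    ring
  · rw [shiftMoment_apply_add 1 0 1 (ω / 2), shiftMoment_apply_add 0 0 1 (ω / 2)]
    simp only [hl0, hl1, sub_zero, pow_one, pow_zero, one_mul, Complex.ofReal_add, s1]
    have i0 := hint (ω / 2) (-(ω / 2))
    have i1 := hint1 (ω / 2) (-(ω / 2))
    simp only [← sub_eq_add_neg] at i0 i1
    rw [integral_add_mul i0 i1, hμ, ← hg]
    push_cast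
    ring
  · rw [shiftMoment_apply_add 1 1 0 (ω / 2), shiftMoment_apply_add 0 1 0 (ω / 2)]
    simp only [hl0, hl1, sub_zero, pow_one, pow_zero, one_mul, Complex.ofReal_add, s1]
    have i0 := hint (-(ω / 2)) (ω / 2)
    have i1 := hint1 (-(ω / 2)) (ω / 2)
    simp only [← sub_eq_add_neg] at i0 i1
    rw [integral_add_mul i0 i1, hμ', hg']
    push_cast
    ring

/-- The changes of mean and variance in terms of the control-marginal state. -/
theorem deltaEnergy_deltaVariance_eq (hω : ω ≠ 0)
    (hmoment : FiniteSecondMoment ρW.energyDensity)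
    (hmean : mean ρW.energyDensity = 0) (hwigner : ρW.WignerMomentExists)
    (hγ : gammaInt ω ρW ≠ 0) {V : Matrix (Fin 2) (Fin 2) ℂ}
    (hV : V ∈ Matrix.unitaryGroup (Fin 2) ℂ) {σ : Matrix (Fin 2) (Fin 2) ℂ}
    (hσ : controlMarginal ω ρS ρW = σ) :
    deltaEnergy ω ρS ρW V / ω = (σ 1 1).re - (rowForm V σ 1).re ∧
    deltaVariance ω ρS ρW V / ω ^ 2 =
      2 * (σ 1 1).re - 2 * (rowForm V !![0, (relMoment ω ρW + 1 / 2) * σ 0 1;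
        (star (relMoment ω ρW) + 1 / 2) * σ 1 0, σ 1 1] 1).re -
      ((σ 1 1).re - (rowForm V σ 1).re) - ((σ 1 1).re - (rowForm V σ 1).re) ^ 2 := by
  rw [controlMarginal_eq] at hσ
  obtain ⟨e00, e11, e01, e10⟩ := shiftMoment_one_apply (ρS := ρS) hω hmoment hmean hwigner hγ
  obtain ⟨-, m1, m2⟩ := energy_moments_finalState (ω := ω) (ρS := ρS) hmoment hV
  obtain ⟨-, n1, n2⟩ := energy_moments_finalState (ω := ω) (ρS := ρS) hmoment
    (one_mem (Matrix.unitaryGroup (Fin 2) ℂ))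
  rw [hσ] at e11 e01 e10 m1 m2 n1 n2
  have hrow : ∀ M : Matrix (Fin 2) (Fin 2) ℂ, rowForm 1 M 1 = M 1 1 := by
    intro M
    simp [rowForm, Fin.sum_univ_two]
  have htr : (shiftMoment ω ρS ρW 1).trace.re = ω * (σ 1 1).re := by
    rw [Matrix.trace_fin_two, e00, e11, zero_add, Complex.re_ofReal_mul]
  have hX : rowForm V (shiftMoment ω ρS ρW 1) 1 = ω * rowForm V
      !![0, (relMoment ω ρW + 1 / 2) * σ 0 1; (star (relMoment ω ρW) + 1 / 2) * σ 1 0, σ 1 1] 1 := by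
    simp only [rowForm, Fin.sum_univ_two, e00, e11, e01, e10, Matrix.of_apply, Matrix.cons_val']
    simp
    ring
  rw [hrow, e11, hrow] at n2
  rw [htr, hrow] at n1
  rw [htr] at m1
  rw [hX] at m2
  have hw : deltaEnergy ω ρS ρW V / ω = (σ 1 1).re - (rowForm V σ 1).re := by
    rw [deltaEnergy, mean, mean]
    simp only [weightEnergyDensity_productState (ω := ω)]
    rw [m1, n1]
    field_simp
    ring
  refine ⟨hw, ?_⟩
  rw [deltaVariance, variance, variance]
  simp only [weightEnergyDensity_productState (ω := ω)]
  rw [m1, m2, n1, n2, Complex.re_ofReal_mul, Complex.re_ofReal_mul]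
  field_simp
  ring

end Reduction

/-! ### Phases, orthonormal bases and qubit energies -/

section Algebra

open ComplexConjugate

/-- The circle of radius |c| contains a point with real part t, and a phase rotates c to it. -/
lemma exists_norm_one_re_mul {c : ℂ} {t : ℝ} (h : |t| ≤ ‖c‖) :
    ∃ e : ℂ, ‖e‖ = 1 ∧ (e * c).re = t := by
  rcases eq_or_ne c 0 with rfl | hc
  · refine ⟨1, norm_one, ?_⟩
    rw [norm_zero] at h
    simp [abs_nonpos_iff.1 h]
  · have hn : ‖(⟨t, Real.sqrt (‖c‖ ^ 2 - t ^ 2)⟩ : ℂ)‖ = ‖c‖ := by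
      have h2 : t ^ 2 ≤ ‖c‖ ^ 2 := sq_le_sq.2 (by rwa [abs_norm])
      rw [← sq_eq_sq₀ (norm_nonneg _) (norm_nonneg _), ← Complex.normSq_eq_norm_sq,
        Complex.normSq_mk, Real.mul_self_sqrt (by linarith)]
      ring
    refine ⟨⟨t, Real.sqrt (‖c‖ ^ 2 - t ^ 2)⟩ / c, ?_, ?_⟩
    · rw [norm_div, hn, div_self (norm_ne_zero_iff.2 hc)]
    · rw [div_mul_cancel₀ _ hc]

variable {x₀ x₁ y₀ y₁ : ℂ}

/-- The orthonormality relations of the columns `(x₀, x₁)` and `(y₀, y₁)`, and of the rows. -/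
structure UnitaryEntries (x₀ x₁ y₀ y₁ : ℂ) : Prop where
  col_x : conj x₀ * x₀ + conj x₁ * x₁ = 1
  col_y : conj y₀ * y₀ + conj y₁ * y₁ = 1
  col_xy : conj x₀ * y₀ + conj x₁ * y₁ = 0
  row_zero : x₀ * conj x₀ + y₀ * conj y₀ = 1
  row_one : x₁ * conj x₁ + y₁ * conj y₁ = 1
  row_zero_one : x₀ * conj x₁ + y₀ * conj y₁ = 0

lemma unitaryEntries_orthonormalBasis
    (ψ : OrthonormalBasis (Fin 2) ℂ (EuclideanSpace ℂ (Fin 2))) :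
    UnitaryEntries (ψ 0 0) (ψ 0 1) (ψ 1 0) (ψ 1 1) := by
  have hinner : ∀ j l, conj (ψ j 0) * ψ l 0 + conj (ψ j 1) * ψ l 1 = if j = l then 1 else 0 := by
    intro j l
    have h := orthonormal_iff_ite.1 ψ.orthonormal j l
    rw [PiLp.inner_apply, Fin.sum_univ_two, RCLike.inner_apply, RCLike.inner_apply] at h
    linear_combination h
  let Q : Matrix (Fin 2) (Fin 2) ℂ := Matrix.of fun i j => ψ j i
  have hQ : star Q * Q = 1 := by
    ext j l
    rw [Matrix.mul_apply, Fin.sum_univ_two, Matrix.one_apply, ← hinner]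
    rfl
  have hQ' : ∀ i k, ψ 0 i * conj (ψ 0 k) + ψ 1 i * conj (ψ 1 k) = if i = k then 1 else 0 := by
    intro i k
    have h' : Q * star Q = 1 := mul_eq_one_comm.1 hQ
    have h := congrFun (congrFun h' i) k
    rw [Matrix.mul_apply, Fin.sum_univ_two, Matrix.one_apply] at h
    exact h
  exact ⟨by simpa using hinner 0 0, by simpa using hinner 1 1, by simpa using hinner 0 1,
    by simpa using hQ' 0 0, by simpa using hQ' 1 1, by simpa using hQ' 0 1⟩

lemma relEnergy_eq {ω : ℝ} (hω : ω ≠ 0) (φ : EuclideanSpace ℂ (Fin 2)) :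
    relEnergy ω φ = ‖φ 1‖ ^ 2 := by
  have h : star (φ 1) * (ω : ℂ) * φ 1 = ((ω * ‖φ 1‖ ^ 2 : ℝ) : ℂ) := by
    have := Complex.conj_mul' (φ 1)
    rw [Complex.star_def]
    push_cast
    linear_combination (ω : ℂ) * this
  rw [relEnergy]
  simp only [hamiltonian, Fin.sum_univ_two, level, Matrix.diagonal_apply]
  simp only [Matrix.cons_val_zero, Matrix.cons_val_one, if_true,
    Fin.zero_eq_one_iff, Fin.one_eq_zero_iff, OfNat.ofNat_ne_one, if_false,
    mul_zero, zero_mul, add_zero, zero_add, Complex.ofReal_zero, h,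
    Complex.ofReal_re]
  field_simp

end Algebra

/-! ### Occupation and coherence coordinates on the set of protocols -/

section PhaseSpace

open ComplexConjugate

variable {x₀ x₁ y₀ y₁ : ℂ}

/-- The density matrix with eigenvalues `p`, `1 - p` and eigenvectors `(x₀, x₁)`, `(y₀, y₁)`. -/
def mixture (p : ℝ) (x₀ x₁ y₀ y₁ : ℂ) : Matrix (Fin 2) (Fin 2) ℂ :=
  Matrix.of fun j l => (p : ℂ) * (![x₀, x₁] j * conj (![x₀, x₁] l)) +
    (1 - (p : ℂ)) * (![y₀, y₁] j * conj (![y₀, y₁] l))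

lemma smul_projector_add_smul_projector (p : ℝ)
    (ψ : OrthonormalBasis (Fin 2) ℂ (EuclideanSpace ℂ (Fin 2))) :
    (p : ℂ) • projector (ψ 0) + (1 - (p : ℂ)) • projector (ψ 1) =
      mixture p (ψ 0 0) (ψ 0 1) (ψ 1 0) (ψ 1 1) := by
  ext j l
  fin_cases j <;> fin_cases l <;> simp [mixture, projector]

lemma mixture_one_one_re (p : ℝ) :
    (mixture p x₀ x₁ y₀ y₁ 1 1).re = p * ‖x₁‖ ^ 2 + (1 - p) * ‖y₁‖ ^ 2 := by
  simp only [mixture, Matrix.of_apply, Matrix.cons_val_one, Matrix.cons_val_zero, Complex.mul_conj']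
  norm_cast

lemma rowForm_mixture_re (p : ℝ) (V : Matrix (Fin 2) (Fin 2) ℂ) :
    (rowForm V (mixture p x₀ x₁ y₀ y₁) 1).re =
      p * ‖V 1 0 * x₀ + V 1 1 * x₁‖ ^ 2 + (1 - p) * ‖V 1 0 * y₀ + V 1 1 * y₁‖ ^ 2 := by
  have h : rowForm V (mixture p x₀ x₁ y₀ y₁) 1 =
      ((p * ‖V 1 0 * x₀ + V 1 1 * x₁‖ ^ 2 + (1 - p) * ‖V 1 0 * y₀ + V 1 1 * y₁‖ ^ 2 : ℝ) : ℂ) := by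
    push_cast
    rw [← Complex.mul_conj', ← Complex.mul_conj']
    simp only [rowForm, mixture, Fin.sum_univ_two, Matrix.of_apply, Matrix.cons_val_one,
      Matrix.cons_val_zero, map_add, map_mul, Complex.star_def]
    ring
  rw [h, Complex.ofReal_re]

/-- The coherence `A B* x₁* y₁` of a vector with components `A*`, `B*` in the eigenbasis. -/
def coherence (x₁ y₁ A B : ℂ) : ℂ := A * conj B * (conj x₁ * y₁)

lemma norm_coherence_sq (A B : ℂ) :
    ‖coherence x₁ y₁ A B‖ ^ 2 = ‖x₁‖ ^ 2 * ‖y₁‖ ^ 2 * (‖A‖ ^ 2 * ‖B‖ ^ 2) := by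
  simp only [coherence, norm_mul, RCLike.norm_conj]
  ring

/-- The two terms are ε₀ and ε₁, so the relative energies sum to one. -/
lemma energy_add_energy (h : UnitaryEntries x₀ x₁ y₀ y₁) : ‖x₁‖ ^ 2 + ‖y₁‖ ^ 2 = 1 := by
  have := h.row_one
  rw [Complex.mul_conj', Complex.mul_conj'] at this
  exact_mod_cast this

lemma norm_sq_components_add (h : UnitaryEntries x₀ x₁ y₀ y₁) {v₀ v₁ : ℂ}
    (hv : ‖v₀‖ ^ 2 + ‖v₁‖ ^ 2 = 1) :
    ‖v₀ * x₀ + v₁ * x₁‖ ^ 2 + ‖v₀ * y₀ + v₁ * y₁‖ ^ 2 = 1 := by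
  have hc : (‖v₀‖ : ℂ) ^ 2 + (‖v₁‖ : ℂ) ^ 2 = 1 := by exact_mod_cast hv
  rw [← Complex.mul_conj', ← Complex.mul_conj'] at hc
  have : (‖v₀ * x₀ + v₁ * x₁‖ : ℂ) ^ 2 + (‖v₀ * y₀ + v₁ * y₁‖ : ℂ) ^ 2 = 1 := by
    rw [← Complex.mul_conj', ← Complex.mul_conj']
    simp only [map_add, map_mul]
    have h10 := congrArg conj h.row_zero_one
    simp only [map_add, map_mul, map_zero, Complex.conj_conj] at h10
    linear_combination (v₀ * conj v₀) * h.row_zero + (v₁ * conj v₁) * h.row_one +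
      (v₀ * conj v₁) * h.row_zero_one + (v₁ * conj v₀) * h10 + hc
  exact_mod_cast this

/-- The first moment after the protocol in terms of the occupation `q` and the coherence. -/
lemma rowForm_moment_re (h : UnitaryEntries x₀ x₁ y₀ y₁) (p : ℝ) (m : ℂ)
    (V : Matrix (Fin 2) (Fin 2) ℂ) {q : ℝ}
    (hq : ‖V 1 0 * x₀ + V 1 1 * x₁‖ ^ 2 = q) (hq' : ‖V 1 0 * y₀ + V 1 1 * y₁‖ ^ 2 = 1 - q) :
    (rowForm V !![0, (m + 1 / 2) * mixture p x₀ x₁ y₀ y₁ 0 1;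
        (star m + 1 / 2) * mixture p x₀ x₁ y₀ y₁ 1 0, mixture p x₀ x₁ y₀ y₁ 1 1] 1).re =
      p * ‖x₁‖ ^ 2 * q + (1 - p) * ‖y₁‖ ^ 2 * (1 - q) +
        (1 - 2 * p) * (2 * m.re) * (‖x₁‖ ^ 2 * ‖y₁‖ ^ 2) * (1 - 2 * q) +
        ((1 - 2 * (1 - 2 * (p : ℂ)) * ((‖y₁‖ ^ 2 : ℝ) * m - (‖x₁‖ ^ 2 : ℝ) * star m)) *
          coherence x₁ y₁ (V 1 0 * x₀ + V 1 1 * x₁) (V 1 0 * y₀ + V 1 1 * y₁)).re := by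
  set A := V 1 0 * x₀ + V 1 1 * x₁ with hA
  set B := V 1 0 * y₀ + V 1 1 * y₁ with hB
  set z := coherence x₁ y₁ A B with hz
  set a : ℝ := ‖x₁‖ ^ 2 with ha
  set b : ℝ := ‖y₁‖ ^ 2 with hb
  have hab : a + b = 1 := energy_add_energy h
  have hQ : A * conj A = (q : ℂ) := by rw [Complex.mul_conj', ← hq]; norm_cast
  have hQ' : B * conj B = ((1 - q : ℝ) : ℂ) := by rw [Complex.mul_conj', ← hq']; norm_cast
  have hx : x₁ * conj x₁ = (a : ℂ) := by rw [Complex.mul_conj', ha]; norm_cast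
  have hy : y₁ * conj y₁ = (b : ℂ) := by rw [Complex.mul_conj', hb]; norm_cast
  have hx0 : x₀ * conj x₀ = (b : ℂ) := by
    linear_combination h.col_x - h.row_one + hy
  have hxy : x₀ * conj y₀ = -(x₁ * conj y₁) := by
    have := congrArg conj h.col_xy
    simp only [map_add, map_mul, map_zero, Complex.conj_conj] at this
    linear_combination this
  have h10 := congrArg conj h.row_zero_one
  simp only [map_add, map_mul, map_zero, Complex.conj_conj] at h10
  -- Completeness of the eigenbasis recovers the row of `V` from its components A and B.
  have hv0 : V 1 0 = A * conj x₀ + B * conj y₀ := by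
    rw [hA, hB]
    linear_combination -(V 1 0) * h.row_zero - (V 1 1) * h10
  have hv1 : V 1 1 = A * conj x₁ + B * conj y₁ := by
    rw [hA, hB]
    linear_combination -(V 1 1) * h.row_one - (V 1 0) * h.row_zero_one
  have hcz : conj z = B * conj A * (x₁ * conj y₁) := by
    rw [hz, coherence]
    simp only [map_mul, Complex.conj_conj]
    ring
  have hS : V 1 1 * conj (V 1 1) = q * a + (1 - q) * b + z + conj z := by
    rw [hcz, hz, coherence, hv1]
    simp only [map_add, map_mul, Complex.conj_conj]
    push_cast at hQ'
    linear_combination (x₁ * conj x₁) * hQ + (q : ℂ) * hx + (y₁ * conj y₁) * hQ' +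
      (1 - q : ℂ) * hy
  have hT : V 1 0 * conj (V 1 1) * mixture p x₀ x₁ y₀ y₁ 0 1 =
      (1 - 2 * p : ℂ) * (a * b * (1 - 2 * q) - b * z + a * conj z) := by
    -- Row orthogonality gives y₀y₁* = −x₀x₁*, so the two eigenprojectors combine with weight p −
    -- (1−p).
    have hσ : mixture p x₀ x₁ y₀ y₁ 0 1 = -(1 - 2 * p : ℂ) * (x₀ * conj x₁) := by
      simp only [mixture, Matrix.of_apply, Matrix.cons_val_one, Matrix.cons_val_zero]
      linear_combination (1 - p : ℂ) * h.row_zero_one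
    have hprod : V 1 0 * conj (V 1 1) * (x₀ * conj x₁) =
        q * (a * b) + b * z - a * conj z - (1 - q) * (a * b) := by
      rw [hcz, hz, coherence, hv1, hv0]
      simp only [map_add, map_mul, Complex.conj_conj]
      push_cast at hQ'
      linear_combination (x₀ * conj x₀ * (x₁ * conj x₁)) * hQ + q * (x₁ * conj x₁) * hx0 +
        (q * b : ℂ) * hx + (A * conj B * conj x₁ * y₁) * hx0 +
        (B * conj A * x₁ * conj x₁) * hxy - (B * conj A * (x₁ * conj y₁)) * hx +
        (x₀ * conj y₀ * (y₁ * conj x₁)) * hQ' + (1 - q : ℂ) * (y₁ * conj x₁) * hxy -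
        (1 - q : ℂ) * (x₁ * conj x₁) * hy - (1 - q : ℂ) * b * hx
    rw [hσ]
    linear_combination -(1 - 2 * p : ℂ) * hprod
  have hT' : V 1 1 * conj (V 1 0) * mixture p x₀ x₁ y₀ y₁ 1 0 =
      (1 - 2 * p : ℂ) * (a * b * (1 - 2 * q) - b * conj z + a * z) := by
    have h1 := congrArg conj hT
    have hσ : conj (mixture p x₀ x₁ y₀ y₁ 0 1) = mixture p x₀ x₁ y₀ y₁ 1 0 := by
      simp only [mixture, Matrix.of_apply, Matrix.cons_val_one, Matrix.cons_val_zero, map_add,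
        map_mul, map_sub, map_one, Complex.conj_conj, Complex.conj_ofReal]
      ring
    simp only [map_mul, map_sub, map_add, map_one, Complex.conj_conj, Complex.conj_ofReal, hσ,
      map_ofNat] at h1
    linear_combination h1
  have hσ11 : mixture p x₀ x₁ y₀ y₁ 1 1 = p * a + (1 - p) * b := by
    simp only [mixture, Matrix.of_apply, Matrix.cons_val_one, Matrix.cons_val_zero, hx, hy]
  have hrow : rowForm V !![0, (m + 1 / 2) * mixture p x₀ x₁ y₀ y₁ 0 1;
      (star m + 1 / 2) * mixture p x₀ x₁ y₀ y₁ 1 0, mixture p x₀ x₁ y₀ y₁ 1 1] 1 =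
      (m + 1 / 2) * ((1 - 2 * p : ℂ) * (a * b * (1 - 2 * q) - b * z + a * conj z)) +
      (conj m + 1 / 2) * ((1 - 2 * p : ℂ) * (a * b * (1 - 2 * q) - b * conj z + a * z)) +
      (q * a + (1 - q) * b + z + conj z) * (p * a + (1 - p) * b) := by
    rw [← hT, ← hT', ← hS, ← hσ11]
    simp only [rowForm, Fin.sum_univ_two, Matrix.of_apply, Matrix.cons_val', Matrix.cons_val_zero,
      Matrix.cons_val_one, Complex.star_def]
    simp
    ring
  have hb' : b = 1 - a := by linarith
  have hre : (rowForm V !![0, (m + 1 / 2) * mixture p x₀ x₁ y₀ y₁ 0 1;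
      (star m + 1 / 2) * mixture p x₀ x₁ y₀ y₁ 1 0, mixture p x₀ x₁ y₀ y₁ 1 1] 1).re =
      2 * (m.re + 1 / 2) * (1 - 2 * p) * (a * b * (1 - 2 * q) - (b - a) * z.re) +
      2 * m.im * (1 - 2 * p) * (a + b) * z.im +
      (q * a + (1 - q) * b + 2 * z.re) * (p * a + (1 - p) * b) := by
    rw [hrow]
    simp [Complex.mul_re, Complex.mul_im]
    ring
  rw [hre]
  simp [Complex.mul_re, Complex.mul_im]
  rw [hb']
  ring

/-- The phase-space coordinates reached by a protocol, in terms of the occupation and the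
coherence. -/
lemma variance_eq_fCentre_sub {p a b q : ℝ} (hp : p < 1 / 2) (hab : a + b = 1) (η c : ℝ) :
    let w := (1 - 2 * p) * (q - a)
    2 * (p * a + (1 - p) * b) - 2 * (p * a * q + (1 - p) * b * (1 - q) +
      (1 - 2 * p) * η * (a * b) * (1 - 2 * q) + c) - w - w ^ 2 =
      fCentre p a b η w - 2 * c := by
  intro w
  have hr : (1 - 2 * p) ≠ 0 := by linarith
  have hw : (b - a) / (1 - 2 * p) * w = (b - a) * (q - a) := by
    simp only [w]
    field_simp
  have hb : b = 1 - a := by linarith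
  rw [fCentre, add_mul, hw]
  simp only [w]
  rw [hb]
  ring

/-- In the occupation variable the two w-dependent factors of the radicand are q and 1 − q. -/
lemma hWidth_eq {p a b q : ℝ} (hp : p < 1 / 2) (hab : a + b = 1) (ξ : ℂ) :
    hWidth p a b ξ ((1 - 2 * p) * (q - a)) =
      2 * (radiusR p ξ * Real.sqrt (a * b * (q * (1 - q)))) := by
  have hr : (1 - 2 * p) ≠ 0 := by linarith
  have e : (1 - 2 * p) * (q - a) / (1 - 2 * p) = q - a := by field_simp
  rw [hWidth, e, mul_assoc, mul_assoc (a * b)]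
  congr 4
  rw [show b = 1 - a by linarith]
  ring

/-- Only the lower row of a unitary influences the phase-space point, so completing a prescribed
unit row is enough. -/
lemma unitary_of_row {v₀ v₁ : ℂ} (hv : ‖v₀‖ ^ 2 + ‖v₁‖ ^ 2 = 1) :
    !![conj v₁, -conj v₀; v₀, v₁] ∈ Matrix.unitaryGroup (Fin 2) ℂ := by
  have hc : (‖v₀‖ : ℂ) ^ 2 + (‖v₁‖ : ℂ) ^ 2 = 1 := by exact_mod_cast hv
  rw [← Complex.mul_conj', ← Complex.mul_conj'] at hc
  rw [Matrix.mem_unitaryGroup_iff]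
  ext i j
  fin_cases i <;> fin_cases j <;>
    simp [Matrix.mul_apply, Fin.sum_univ_two, Matrix.star_apply]
  · linear_combination hc
  · ring
  · ring
  · linear_combination hc

lemma norm_sq_row {V : Matrix (Fin 2) (Fin 2) ℂ} (hV : V ∈ Matrix.unitaryGroup (Fin 2) ℂ) :
    ‖V 1 0‖ ^ 2 + ‖V 1 1‖ ^ 2 = 1 := by
  have h := congrFun (congrFun (Matrix.mem_unitaryGroup_iff.1 hV) 1) 1
  rw [Matrix.mul_apply, Fin.sum_univ_two, Matrix.star_apply, Matrix.star_apply, Complex.star_def,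
    Complex.mul_conj', Complex.mul_conj', Matrix.one_apply_eq] at h
  exact_mod_cast h

/-- Every occupation and every admissible value of the coherence is reached by a unitary. -/
lemma exists_unitary_coherence (h : UnitaryEntries x₀ x₁ y₀ y₁) {q t : ℝ} {c : ℂ} (hq0 : 0 ≤ q)
    (hq1 : q ≤ 1) (ht : |t| ≤ ‖c‖ * Real.sqrt (‖x₁‖ ^ 2 * ‖y₁‖ ^ 2 * (q * (1 - q)))) :
    ∃ V ∈ Matrix.unitaryGroup (Fin 2) ℂ, ‖V 1 0 * x₀ + V 1 1 * x₁‖ ^ 2 = q ∧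
      ‖V 1 0 * y₀ + V 1 1 * y₁‖ ^ 2 = 1 - q ∧
      (c * coherence x₁ y₁ (V 1 0 * x₀ + V 1 1 * x₁) (V 1 0 * y₀ + V 1 1 * y₁)).re = t := by
  have hq1' : 0 ≤ 1 - q := by linarith
  have hn : ‖c * coherence x₁ y₁ (Real.sqrt q) (Real.sqrt (1 - q))‖ =
      ‖c‖ * Real.sqrt (‖x₁‖ ^ 2 * ‖y₁‖ ^ 2 * (q * (1 - q))) := by
    rw [norm_mul, ← Real.sqrt_sq (norm_nonneg (coherence x₁ y₁ _ _)), norm_coherence_sq,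
      Complex.norm_real, Complex.norm_real, Real.norm_of_nonneg (Real.sqrt_nonneg _),
      Real.norm_of_nonneg (Real.sqrt_nonneg _), Real.sq_sqrt hq0, Real.sq_sqrt hq1']
  rw [← hn] at ht
  obtain ⟨e, he, het⟩ := exists_norm_one_re_mul ht
  -- The whole phase is put on A while B stays real: this rotates the coherence by e and leaves the
  -- occupations unchanged.
  set A : ℂ := e * Real.sqrt q with hA
  set B : ℂ := (Real.sqrt (1 - q) : ℂ) with hB
  have hAn : ‖A‖ ^ 2 = q := by
    rw [hA, norm_mul, he, one_mul, Complex.norm_real, Real.norm_of_nonneg (Real.sqrt_nonneg _),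
      Real.sq_sqrt hq0]
  have hBn : ‖B‖ ^ 2 = 1 - q := by
    rw [hB, Complex.norm_real, Real.norm_of_nonneg (Real.sqrt_nonneg _), Real.sq_sqrt hq1']
  have hyx := congrArg conj h.col_xy
  simp only [map_add, map_mul, map_zero, Complex.conj_conj] at hyx
  have hxA : (A * conj x₀ + B * conj y₀) * x₀ + (A * conj x₁ + B * conj y₁) * x₁ = A := by
    linear_combination A * h.col_x + B * hyx
  have hyB : (A * conj x₀ + B * conj y₀) * y₀ + (A * conj x₁ + B * conj y₁) * y₁ = B := by
    linear_combination B * h.col_y + A * h.col_xy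
  have hrow : ‖A * conj x₀ + B * conj y₀‖ ^ 2 + ‖A * conj x₁ + B * conj y₁‖ ^ 2 = 1 := by
    have hc : A * conj A + B * conj B = 1 := by
      rw [Complex.mul_conj', Complex.mul_conj']
      exact_mod_cast (by rw [hAn, hBn]; ring : ‖A‖ ^ 2 + ‖B‖ ^ 2 = 1)
    have : (‖A * conj x₀ + B * conj y₀‖ : ℂ) ^ 2 + (‖A * conj x₁ + B * conj y₁‖ : ℂ) ^ 2 = 1 := by
      rw [← Complex.mul_conj', ← Complex.mul_conj']
      simp only [map_add, map_mul, Complex.conj_conj]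
      linear_combination (A * conj A) * h.col_x + (B * conj B) * h.col_y +
        (A * conj B) * h.col_xy + (B * conj A) * hyx + hc
    exact_mod_cast this
  refine ⟨_, unitary_of_row hrow, ?_, ?_, ?_⟩
  · simpa [hxA] using hAn
  · simpa [hyB] using hBn
  · simp only [Matrix.of_apply, Matrix.cons_val', Matrix.cons_val_zero, Matrix.cons_val_one,
      Matrix.cons_val_fin_one]
    rw [hxA, hyB, ← het, hA]
    congr 1
    simp only [coherence]
    ring

end PhaseSpace

section PhaseSpace

variable {x₀ x₁ y₀ y₁ : ℂ}

/-- The phase-space point of a protocol in terms of the occupation `q` and the coherence. -/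
theorem phase_space_point {ω : ℝ} {ρS : Matrix (Fin 2) (Fin 2) ℂ} {ρW : WeightState}
    (hω : ω ≠ 0) (hmoment : FiniteSecondMoment ρW.energyDensity)
    (hmean : mean ρW.energyDensity = 0) (hwigner : ρW.WignerMomentExists)
    (hγ : gammaInt ω ρW ≠ 0) (h : UnitaryEntries x₀ x₁ y₀ y₁) {p : ℝ} (hp : p < 1 / 2)
    (hσ : controlMarginal ω ρS ρW = mixture p x₀ x₁ y₀ y₁)
    {V : Matrix (Fin 2) (Fin 2) ℂ} (hV : V ∈ Matrix.unitaryGroup (Fin 2) ℂ) {q : ℝ}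
    (hq : ‖V 1 0 * x₀ + V 1 1 * x₁‖ ^ 2 = q) (hq' : ‖V 1 0 * y₀ + V 1 1 * y₁‖ ^ 2 = 1 - q) :
    deltaEnergy ω ρS ρW V / ω = (1 - 2 * p) * (q - ‖x₁‖ ^ 2) ∧
    deltaVariance ω ρS ρW V / ω ^ 2 =
      fCentre p (‖x₁‖ ^ 2) (‖y₁‖ ^ 2) (etaInt ω ρW).re ((1 - 2 * p) * (q - ‖x₁‖ ^ 2)) -
        2 * ((1 - 2 * (1 - 2 * (p : ℂ)) * xiInt ω (‖x₁‖ ^ 2) (‖y₁‖ ^ 2) ρW) *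
          coherence x₁ y₁ (V 1 0 * x₀ + V 1 1 * x₁) (V 1 0 * y₀ + V 1 1 * y₁)).re := by
  obtain ⟨h1, h2⟩ := deltaEnergy_deltaVariance_eq hω hmoment hmean hwigner hγ hV hσ
  have hab := energy_add_energy h
  have hw : (mixture p x₀ x₁ y₀ y₁ 1 1).re - (rowForm V (mixture p x₀ x₁ y₀ y₁) 1).re =
      (1 - 2 * p) * (q - ‖x₁‖ ^ 2) := by
    rw [mixture_one_one_re, rowForm_mixture_re, hq, hq',
      show ‖y₁‖ ^ 2 = 1 - ‖x₁‖ ^ 2 by linarith]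
    ring
  rw [hw] at h1 h2
  refine ⟨h1, ?_⟩
  have hη : (etaInt ω ρW).re = 2 * (relMoment ω ρW).re := by
    rw [etaInt_eq hmoment hwigner, Complex.star_def, Complex.add_re, Complex.conj_re]
    ring
  rw [h2, mixture_one_one_re, rowForm_moment_re h p _ V hq hq', hη, xiInt_eq hmoment hwigner]
  exact variance_eq_fCentre_sub hp hab _ _

end PhaseSpace

end QubitWeight

end

/-! ### The attainable region -/

theorem proposition2
    (ω : ℝ) (hω : 0 < ω)
    (ρS : Matrix (Fin 2) (Fin 2) ℂ) (hρS : ρS.PosSemidef) (htr : ρS.trace = 1)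
    (ρW : QubitWeight.WeightState)
    (hmoment : QubitWeight.FiniteSecondMoment ρW.energyDensity)
    (hmean : QubitWeight.mean ρW.energyDensity = 0)
    (hwigner : ρW.WignerMomentExists)
    (hγ : QubitWeight.gammaInt ω ρW ≠ 0)
    (p : ℝ) (hp : p < 1 / 2)
    (ψ : OrthonormalBasis (Fin 2) ℂ (EuclideanSpace ℂ (Fin 2)))
    (hσ : QubitWeight.controlMarginal ω ρS ρW =
      (p : ℂ) • QubitWeight.projector (ψ 0) + (1 - (p : ℂ)) • QubitWeight.projector (ψ 1))
    (ε₀ ε₁ : ℝ)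
    (hε₀ : ε₀ = QubitWeight.relEnergy ω (ψ 0))
    (hε₁ : ε₁ = QubitWeight.relEnergy ω (ψ 1))
    (η ξ : ℂ)
    (hη : η = QubitWeight.etaInt ω ρW)
    (hξ : ξ = QubitWeight.xiInt ω ε₀ ε₁ ρW) :
    η.im = 0 ∧
    (∀ V : Matrix.unitaryGroup (Fin 2) ℂ, QubitWeight.FiniteSecondMoment
      (QubitWeight.weightEnergyDensity (QubitWeight.finalState ω ρS ρW V))) ∧
    Set.range (fun V : Matrix.unitaryGroup (Fin 2) ℂ =>
        (QubitWeight.deltaEnergy ω ρS ρW V / ω, QubitWeight.deltaVariance ω ρS ρW V / ω ^ 2)) =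
      {x : ℝ × ℝ |
        x.1 ∈ Set.Icc (-ε₀ * (1 - 2 * p)) (ε₁ * (1 - 2 * p)) ∧
        x.2 ∈ Set.Icc
          (QubitWeight.fCentre p ε₀ ε₁ η.re x.1 - QubitWeight.hWidth p ε₀ ε₁ ξ x.1)
          (QubitWeight.fCentre p ε₀ ε₁ η.re x.1 + QubitWeight.hWidth p ε₀ ε₁ ξ x.1)} := by
  open QubitWeight in
  rw [relEnergy_eq hω.ne'] at hε₀ hε₁
  rw [smul_projector_add_smul_projector] at hσ
  have hu := unitaryEntries_orthonormalBasis ψ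
  have hab := energy_add_energy hu
  have hr : 0 < 1 - 2 * p := by linarith
  have hpoint := fun {V : Matrix (Fin 2) (Fin 2) ℂ} (hV : V ∈ Matrix.unitaryGroup (Fin 2) ℂ)
    {q : ℝ} => phase_space_point (q := q) hω.ne' hmoment hmean hwigner hγ hu hp hσ hV
  rw [← hε₀, ← hε₁] at hab
  rw [← hε₀, ← hε₁, ← hη, ← hξ] at hpoint
  refine ⟨?_, fun V => (energy_moments_finalState hmoment V.2).1, ?_⟩
  · rw [hη, etaInt_eq hmoment hwigner, Complex.star_def, Complex.add_conj, Complex.ofReal_im]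
  · ext ⟨w, v⟩
    simp only [Set.mem_range, Set.mem_ofPred_eq, Prod.mk.injEq, Set.mem_Icc]
    constructor
    · rintro ⟨V, rfl, rfl⟩
      set q := ‖V.1 1 0 * ψ 0 0 + V.1 1 1 * ψ 0 1‖ ^ 2 with hq
      have hq' : ‖V.1 1 0 * ψ 1 0 + V.1 1 1 * ψ 1 1‖ ^ 2 = 1 - q := by
        linarith [norm_sq_components_add hu (norm_sq_row V.2)]
      have hq0 : 0 ≤ q := sq_nonneg _
      have hq1 : 0 ≤ 1 - q := hq' ▸ sq_nonneg _
      obtain ⟨h1, h2⟩ := hpoint V.2 hq.symm hq'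
      rw [h1, h2, hWidth_eq hp hab]
      have hz := Complex.abs_re_le_norm ((1 - 2 * (1 - 2 * (p : ℂ)) * ξ) *
        coherence (ψ 0 1) (ψ 1 1) (V.1 1 0 * ψ 0 0 + V.1 1 1 * ψ 0 1)
          (V.1 1 0 * ψ 1 0 + V.1 1 1 * ψ 1 1))
      rw [norm_mul, ← Real.sqrt_sq (norm_nonneg (coherence _ _ _ _)), norm_coherence_sq, ← hq, hq',
        ← hε₀, ← hε₁, ← radiusR, abs_le] at hz
      refine ⟨⟨?_, ?_⟩, ?_, ?_⟩
      · nlinarith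
      · nlinarith
      · linarith [hz.2]
      · linarith [hz.1]
    · rintro ⟨⟨hw0, hw1⟩, hv0, hv1⟩
      -- Inverting the affine relation between work and occupation; the bounds on w become 0 ≤ q ≤ 1
      -- because ε₀ + ε₁ = 1.
      obtain ⟨q, rfl⟩ : ∃ q, w = (1 - 2 * p) * (q - ε₀) :=
        ⟨ε₀ + w / (1 - 2 * p), by field_simp; ring⟩
      have hq0 : 0 ≤ q := by nlinarith
      have hq1 : q ≤ 1 := by nlinarith
      rw [hWidth_eq hp hab] at hv0 hv1
      -- The required real part is (f(w) − v)/2, since the variance change is f(w) minus twice it.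
      have ht : |(fCentre p ε₀ ε₁ η.re ((1 - 2 * p) * (q - ε₀)) - v) / 2| ≤
          ‖1 - 2 * (1 - 2 * (p : ℂ)) * ξ‖ *
            Real.sqrt (‖ψ 0 1‖ ^ 2 * ‖ψ 1 1‖ ^ 2 * (q * (1 - q))) := by
        rw [← hε₀, ← hε₁, ← radiusR, abs_le]
        constructor <;> linarith
      obtain ⟨V, hV, hVq, hVq', hVt⟩ := exists_unitary_coherence hu hq0 hq1 ht
      obtain ⟨h1, h2⟩ := hpoint hV hVq hVq'
      refine ⟨⟨V, hV⟩, h1, ?_⟩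
      rw [h2, hVt]
      ring
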